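/- Let $d\ge 2$. A finite set $P\subset\mathbb{R}^d$ is in general position if no $d+1$ of its points lie on a common hyperplane. A $(d-1)$-simplex in $P$ is a nondegenerate $(d-1)$-dimensional simplex whose $d$ vertices belong to $P$. Two such simplices strongly cross if their relative interiors intersect and they have no common vertex. A crossing family of size $k$ in $P$ is a set of $k$ pairwise strongly crossing $(d-1)$-simplices in $P$. (i) There is an absolute constant $c>0$ such that every set $P$ of $n\ge 3$ points in general position in $\mathbb{R}^2$ contains a crossing family of size at least $c\sqrt{n}$. (ii) For every $d\ge 3$ there is a constant $c_d>0$, depending only on $d$, such that every set $P$ of $n\ge d+1$ points in general position in $\mathbb{R}^d$ contains a crossing family of size at least $$c_d\, n^{\frac{1}{2\prod_{i=3}^{d}(i^2-i+1)}}.$$ -/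

import Mathlib

/-- A finite point set in `ℝ^d` is in general position if no `d + 1` of its members lie on a common
hyperplane (an affine subspace of dimension `d - 1`). -/
def InGeneralPosition {d : ℕ} (P : Finset (EuclideanSpace ℝ (Fin d))) : Prop :=
  ∀ S : Finset (EuclideanSpace ℝ (Fin d)), S ⊆ P → S.card = d + 1 →
    ¬ ∃ H : AffineSubspace ℝ (EuclideanSpace ℝ (Fin d)),
        (H : Set (EuclideanSpace ℝ (Fin d))).Nonempty ∧
        Module.finrank ℝ H.direction + 1 = d ∧
        (S : Set (EuclideanSpace ℝ (Fin d))) ⊆ H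

/-- Two simplices strongly cross if their (relative) interiors intersect and they have no common
vertex. `Affine.Simplex.interior` is the set of points all of whose barycentric coordinates with
respect to the vertices lie strictly between `0` and `1`. -/
def StronglyCross {d m : ℕ} (s t : Affine.Simplex ℝ (EuclideanSpace ℝ (Fin d)) m) : Prop :=
  (s.interior ∩ t.interior).Nonempty ∧ Disjoint (Set.range s.points) (Set.range t.points)

/-- A crossing family in `P ⊆ ℝ^d`: a finite set of (nondegenerate) `(d - 1)`-dimensional simplices,
all of whose vertices belong to `P`, any two distinct members of which strongly cross. -/
def IsCrossingFamily {d : ℕ} (P : Finset (EuclideanSpace ℝ (Fin d)))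
    (F : Finset (Affine.Simplex ℝ (EuclideanSpace ℝ (Fin d)) (d - 1))) : Prop :=
  (∀ s ∈ F, ∀ i, s.points i ∈ P) ∧ ∀ s ∈ F, ∀ t ∈ F, s ≠ t → StronglyCross s t

/-!
Points of `ℝ^d` are placed at height `1` in `ℝ^(d+1)`, so that crossing simplices become simplicial
cones with intersecting interiors, and the bound is proved by induction on `d`.

In the plane, the set is halved and a cutting argument in the style of Aronov, Erdős, Goddard,
Kleitman, Klugerman, Pach and Schulman yields `Ω(√n)` pairwise crossing segments.

For the step from `d` to `d + 1`, a cutting of a suitable hyperplane arrangement gives subsets `A`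
and `B` on different sides of a hyperplane such that no hyperplane spanned by points of `A`
separates points of `B`. Project `A` centrally from a point of `B` and take a crossing family of the
projection. While the centre moves along a segment between points of `B` it never meets a hyperplane
spanned by `A`, so crossings persist; it follows that adjoining a different point of `B` to each
member of the family gives a crossing family of one more dimension. The exponent is divided by
`d (d + 1) + 1`, the cost of balancing the sizes of `A` and `B`.
-/

open Finset Module

variable {α : Type*}

section Configurations

variable {E E' V : Type*} [AddCommGroup E] [Module ℝ E] [AddCommGroup E'] [Module ℝ E']
  [AddCommGroup V] [Module ℝ V]

/-- General position of the vector configuration `u i`, `i ∈ P`: as far as the dimension permits,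
its members are linearly independent. -/
def IsGeneric (u : α → E) (P : Finset α) : Prop :=
  ∀ S ⊆ P, #S ≤ finrank ℝ E → LinearIndepOn ℝ u (S : Set α)

/-- The open cones spanned by `u i`, `i ∈ s`, and by `u i`, `i ∈ t`, intersect. This is meant for
disjoint `s` and `t`, so that a single function `w` can record both positive combinations. -/
def ConesCross (u : α → E) (s t : Finset α) : Prop :=
  ∃ w : α → ℝ, (∀ i ∈ s, 0 < w i) ∧ (∀ i ∈ t, 0 < w i) ∧
    ∑ i ∈ s, w i • u i = ∑ i ∈ t, w i • u i

/-- The vector configuration of an affine point configuration: points are placed at height `1`, so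
that affine dependences become linear dependences and simplices become cones. -/
def homogenize (v : α → V) (i : α) : V × ℝ := (v i, 1)

/-- The crossing families of a vector configuration: sets of `k`-element index sets in `P` that are
pairwise disjoint and span pairwise intersecting open cones. -/
structure IsConeFamily (u : α → E) (P : Finset α) (k : ℕ) (F : Finset (Finset α)) : Prop where
  subset : ∀ s ∈ F, s ⊆ P
  card_eq : ∀ s ∈ F, #s = k
  disjoint : (F : Set (Finset α)).Pairwise Disjoint
  conesCross : (F : Set (Finset α)).Pairwise (ConesCross u)

lemma IsGeneric.mono {u : α → E} {P Q : Finset α} (h : IsGeneric u Q) (hPQ : P ⊆ Q) :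
    IsGeneric u P :=
  fun S hS => h S (hS.trans hPQ)

lemma ConesCross.symm {u : α → E} {s t : Finset α} (h : ConesCross u s t) : ConesCross u t s :=
  let ⟨w, hs, ht, hw⟩ := h
  ⟨w, ht, hs, hw.symm⟩

lemma conesCross_map_iff {e : E →ₗ[ℝ] E'} (he : Function.Injective e) {u : α → E}
    {s t : Finset α} : ConesCross (fun i => e (u i)) s t ↔ ConesCross u s t := by
  simp only [ConesCross, ← map_smul, ← map_sum, he.eq_iff]

lemma IsConeFamily.singleton (u : α → E) {P s : Finset α} (hs : s ⊆ P) :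
    IsConeFamily u P #s {s} where
  subset := by simpa using hs
  card_eq := by simp
  disjoint := by simp
  conesCross := by simp

lemma IsConeFamily.of_forall_conesCross {u : α → E} {u' : α → E'} {P : Finset α} {k : ℕ}
    {F : Finset (Finset α)} (h : IsConeFamily u P k F)
    (hu : ∀ s ⊆ P, ∀ t ⊆ P, ConesCross u s t → ConesCross u' s t) : IsConeFamily u' P k F :=
  { h with
    conesCross := fun s hs t ht hst =>
      hu s (h.subset s hs) t (h.subset t ht) (h.conesCross hs ht hst) }

lemma isConeFamily_map_iff {e : E →ₗ[ℝ] E'} (he : Function.Injective e) {u : α → E}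
    {P : Finset α} {k : ℕ} {F : Finset (Finset α)} :
    IsConeFamily (fun i => e (u i)) P k F ↔ IsConeFamily u P k F :=
  ⟨fun h => h.of_forall_conesCross fun _ _ _ _ => (conesCross_map_iff he).1,
    fun h => h.of_forall_conesCross fun _ _ _ _ => (conesCross_map_iff he).2⟩

lemma exists_isConeFamily_of_pairwise {ι : Type*} {u : α → E} {P : Finset α} {k : ℕ} (hk : 0 < k)
    {I : Finset ι} {f : ι → Finset α} (hP : ∀ i ∈ I, f i ⊆ P) (hcard : ∀ i ∈ I, #(f i) = k)
    (hf : ∀ i ∈ I, ∀ j ∈ I, i ≠ j → Disjoint (f i) (f j) ∧ ConesCross u (f i) (f j)) :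
    ∃ F, IsConeFamily u P k F ∧ #F = #I := by
  classical
  have hinj : Set.InjOn f I := fun i hi j hj hij => by
    by_contra hne
    have hempty : f i = ∅ := by
      rw [← disjoint_self_iff_empty]
      exact hij ▸ (hf i hi j hj hne).1
    rw [← hcard i hi, hempty, card_empty] at hk
    exact hk.false
  refine ⟨I.image f, ⟨forall_mem_image.2 hP, forall_mem_image.2 hcard, ?_, ?_⟩,
    card_image_of_injOn hinj⟩
  · rw [coe_image, hinj.pairwise_image]
    exact fun i hi j hj hne => (hf i hi j hj hne).1
  · rw [coe_image, hinj.pairwise_image]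
    exact fun i hi j hj hne => (hf i hi j hj hne).2

lemma IsGeneric.injOn {u : α → E} {P : Finset α} (h : IsGeneric u P) (hE : 2 ≤ finrank ℝ E) :
    Set.InjOn u (P : Set α) := by
  classical
  intro a ha b hb hab
  have hli := h {a, b} (insert_subset ha (singleton_subset_iff.2 hb)) (card_le_two.trans hE)
  exact hli.injOn (by simp) (by simp) hab

lemma isGeneric_map_iff (e : E ≃ₗ[ℝ] E') {u : α → E} {P : Finset α} :
    IsGeneric (fun i => e (u i)) P ↔ IsGeneric u P := by
  simp only [IsGeneric, e.finrank_eq]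
  exact forall₃_congr fun S _ _ => e.toLinearMap.linearIndepOn_iff_of_injOn e.injective.injOn

lemma IsGeneric.injOn_of_homogenize {v : α → V} {P : Finset α} [FiniteDimensional ℝ V]
    (h : IsGeneric (homogenize v) P) (hV : 1 ≤ finrank ℝ V) : Set.InjOn v (P : Set α) :=
  fun a ha b hb hab => h.injOn (by rw [finrank_prod, finrank_self]; omega) ha hb
    (by simp only [homogenize, hab])

lemma isGeneric_homogenize_map_iff (e : V ≃ₗ[ℝ] E) {v : α → V} {P : Finset α} :
    IsGeneric (homogenize fun i => e (v i)) P ↔ IsGeneric (homogenize v) P :=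
  isGeneric_map_iff (u := homogenize v) (e.prodCongr (LinearEquiv.refl ℝ ℝ))

lemma isConeFamily_homogenize_map_iff (e : V ≃ₗ[ℝ] E) {v : α → V} {P : Finset α} {k : ℕ}
    {F : Finset (Finset α)} :
    IsConeFamily (homogenize fun i => e (v i)) P k F ↔ IsConeFamily (homogenize v) P k F :=
  isConeFamily_map_iff (u := homogenize v) (e.prodCongr (LinearEquiv.refl ℝ ℝ)).injective

lemma exists_dual_injOn {v : α → V} {P : Finset α}
    (hv : Set.InjOn v (P : Set α)) : ∃ φ : Dual ℝ V, Set.InjOn (fun i => φ (v i)) (P : Set α) := by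
  classical
  obtain ⟨φ, hφ⟩ := exists_dual_forall_apply_ne_zero
    (K := ℝ) (fun x : {x : P × P // x.1 ≠ x.2} => v x.1.1 - v x.1.2) fun x => sub_ne_zero.2 fun h =>
      x.2 (Subtype.ext (hv x.1.1.2 x.1.2.2 h))
  refine ⟨φ, fun a ha b hb hab => ?_⟩
  by_contra hne
  exact hφ ⟨(⟨a, ha⟩, ⟨b, hb⟩), fun h => hne (congrArg Subtype.val h)⟩
    (by rw [map_sub, sub_eq_zero]; exact hab)

lemma exists_linearEquiv_prod [FiniteDimensional ℝ V] [FiniteDimensional ℝ E]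
    (hE : finrank ℝ E = finrank ℝ V + 1) {φ : Dual ℝ E} (hφ : φ ≠ 0) :
    ∃ e : E ≃ₗ[ℝ] V × ℝ, ∀ x, (e x).2 = φ x := by
  obtain ⟨π, hπ⟩ := (LinearMap.ker φ).subtype.exists_leftInverse_of_injective
    (Submodule.ker_subtype _)
  have g : LinearMap.ker φ ≃ₗ[ℝ] V := LinearEquiv.ofFinrankEq _ _ (by
    have := Dual.finrank_ker_add_one_of_ne_zero hφ
    omega)
  have hinj : Function.Injective ((g.toLinearMap ∘ₗ π).prod φ) := by
    rw [← LinearMap.ker_eq_bot, LinearMap.ker_eq_bot']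
    intro x hx
    obtain ⟨hgx, hφx⟩ := Prod.mk.inj hx
    have hπx : π x = ⟨x, hφx⟩ := LinearMap.congr_fun hπ ⟨x, hφx⟩
    have := g.map_eq_zero_iff.1 hgx
    rw [hπx] at this
    exact congrArg Subtype.val this
  exact ⟨LinearMap.linearEquivOfInjective _ hinj (by rw [hE, finrank_prod, finrank_self]),
    fun x => rfl⟩

end Configurations

section Planar

lemma exists_isAntichain_or_isChain (r : α → α → Prop) [IsStrictOrder α r] (m j : ℕ)
    (S : Finset α) (hS : j * m < #S) :
    (∃ T ⊆ S, m ≤ #T ∧ IsAntichain r (T : Set α)) ∨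
      ∃ T ⊆ S, j < #T ∧ IsChain r (T : Set α) ∧ ∃ t ∈ T, ∀ a ∈ T, a ≠ t → r t a := by
  classical
  induction j generalizing S with
  | zero =>
    obtain ⟨a, ha⟩ := card_pos.1 (by simpa only [Nat.zero_mul] using hS)
    exact Or.inr ⟨{a}, by simpa using ha, by simp, by simp, a, by simp, by simp⟩
  | succ j ih =>
    by_cases hm : m ≤ #{a ∈ S | ∀ b ∈ S, ¬ r b a}
    · exact Or.inl ⟨_, filter_subset _ _, hm, fun a ha b hb _ =>
        (mem_filter.1 hb).2 a (mem_filter.1 ha).1⟩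
    have hcard : j * m < #(S \ {a ∈ S | ∀ b ∈ S, ¬ r b a}) := by
      rw [card_sdiff_of_subset (filter_subset _ _)]
      linarith [Nat.succ_mul j m, Nat.sub_add_cancel (card_filter_le S fun a => ∀ b ∈ S, ¬ r b a)]
    rcases ih _ hcard with ⟨T, hT, hTm⟩ | ⟨T, hT, hjT, hchain, t, htT, ht⟩
    · exact Or.inl ⟨T, hT.trans sdiff_subset, hTm⟩
    obtain ⟨b, hb, hbt⟩ : ∃ b ∈ S, r b t := by
      by_contra! h
      exact (mem_sdiff.1 (hT htT)).2 (mem_filter.2 ⟨(mem_sdiff.1 (hT htT)).1, h⟩)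
    have hbT : ∀ a ∈ T, r b a := fun a ha =>
      (eq_or_ne a t).elim (fun h => h ▸ hbt) fun h => trans_of r hbt (ht a ha h)
    have hb_notMem : b ∉ T := fun h => irrefl_of r b (hbT b h)
    refine Or.inr ⟨insert b T, insert_subset hb (hT.trans sdiff_subset), ?_, ?_, b,
      mem_insert_self _ _, fun a ha hab => hbT a ((mem_insert.1 ha).resolve_left hab)⟩
    · rwa [card_insert_of_notMem hb_notMem, Nat.add_lt_add_iff_right]
    · rw [coe_insert]
      exact hchain.insert fun a ha _ => Or.inl (hbT a ha)

/-- The **Erdős–Szekeres theorem** for a finite set with two real-valued functions. -/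
lemma exists_strictMono_or_antitone_of_sq_le_card (x θ : α → ℝ) (m : ℕ) (S : Finset α)
    (hS : m ^ 2 ≤ #S) :
    ∃ T ⊆ S, m ≤ #T ∧ ((∀ a ∈ T, ∀ b ∈ T, x a < x b → θ a < θ b) ∨
      ∀ a ∈ T, ∀ b ∈ T, x a < x b → θ b ≤ θ a) := by
  rcases m with _ | m
  · exact ⟨∅, by simp, by simp, by simp⟩
  let r : α → α → Prop := fun a b => x a < x b ∧ θ a < θ b
  have : IsStrictOrder α r :=
    { irrefl := fun a h => h.1.false
      trans := fun a b c hab hbc => ⟨hab.1.trans hbc.1, hab.2.trans hbc.2⟩ }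
  have hmS : m * (m + 1) < #S := by linarith [sq (m + 1), Nat.succ_mul m (m + 1)]
  rcases exists_isAntichain_or_isChain r (m + 1) m S hmS with
    ⟨T, hT, hmT, hanti⟩ | ⟨T, hT, hmT, hchain, -⟩
  · refine ⟨T, hT, hmT, Or.inr fun a ha b hb hab => not_lt.1 fun hθ => ?_⟩
    exact hanti ha hb (ne_of_apply_ne x hab.ne) ⟨hab, hθ⟩
  · refine ⟨T, hT, hmT, Or.inl fun a ha b hb hab => ?_⟩
    exact (hchain ha hb (ne_of_apply_ne x hab.ne)).elim And.right fun h => absurd h.1 hab.not_gt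

lemma exists_initial_subset (x : α → ℝ) {S : Finset α} (hx : Set.InjOn x S) {j : ℕ}
    (hj : j ≤ #S) : ∃ T ⊆ S, #T = j ∧ ∀ a ∈ T, ∀ b ∈ S, b ∉ T → x a < x b := by
  classical
  induction j with
  | zero => exact ⟨∅, by simp, by simp, by simp⟩
  | succ j ih =>
    obtain ⟨T, hTS, hTj, hT⟩ := ih (by omega)
    have hne : (S \ T).Nonempty := card_pos.1 (by rw [card_sdiff_of_subset hTS]; omega)
    obtain ⟨c, hc, hmin⟩ := exists_min_image (S \ T) x hne
    obtain ⟨hcS, hcT⟩ := mem_sdiff.1 hc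
    refine ⟨insert c T, insert_subset hcS hTS, by rw [card_insert_of_notMem hcT, hTj], ?_⟩
    intro a ha b hb hb_insert
    obtain ⟨hbc, hbT⟩ := not_or.1 (mem_insert.not.1 hb_insert)
    rcases mem_insert.1 ha with rfl | ha
    · exact (hmin b (mem_sdiff.2 ⟨hb, hbT⟩)).lt_of_ne fun h => hbc (hx hcS hb h).symm
    · exact hT a ha b hb hbT

lemma exists_weak_median (h : α → ℝ) {S : Finset α} {k : ℕ} (hS : 2 * k + 1 ≤ #S) :
    ∃ s ∈ S, k + 1 ≤ #{a ∈ S | h a ≤ h s} ∧ k + 1 ≤ #{a ∈ S | h s ≤ h a} := by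
  classical
  have hne : {s ∈ S | k + 1 ≤ #{a ∈ S | h a ≤ h s}}.Nonempty := by
    obtain ⟨s, hs, hmax⟩ := exists_max_image S h (card_pos.1 (by omega))
    exact ⟨s, mem_filter.2 ⟨hs, by rw [filter_true_of_mem hmax]; omega⟩⟩
  obtain ⟨s, hs, hmin⟩ := exists_min_image _ h hne
  obtain ⟨hsS, hs_le⟩ := mem_filter.1 hs
  have hlt : #{a ∈ S | h a < h s} ≤ k := by
    by_contra! hk
    obtain ⟨t, ht, hmax⟩ := exists_max_image {a ∈ S | h a < h s} h (card_pos.1 (by omega))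
    obtain ⟨htS, hts⟩ := mem_filter.1 ht
    have hsub : {a ∈ S | h a < h s} ⊆ {a ∈ S | h a ≤ h t} := fun a ha =>
      mem_filter.2 ⟨(mem_filter.1 ha).1, hmax a ha⟩
    exact hts.not_ge (hmin t (mem_filter.2 ⟨htS, hk.trans_le (card_le_card hsub)⟩))
  have := card_filter_add_card_filter_not (s := S) (fun a => h s ≤ h a)
  simp only [not_le] at this
  exact ⟨s, hsS, hs_le, by omega⟩

lemma exists_strictMono_enum (x : α → ℝ) {S : Finset α} (hx : Set.InjOn x S) {k : ℕ}
    (hk : k ≤ #S) : ∃ a : Fin k → α, (∀ i, a i ∈ S) ∧ StrictMono fun i => x (a i) := by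
  classical
  have hcard : k ≤ #(S.image x) := by rwa [card_image_of_injOn hx]
  choose a ha hxa using fun i => mem_image.1 ((S.image x).orderEmbOfCardLe_mem hcard i)
  refine ⟨a, ha, ?_⟩
  simpa only [hxa] using ((S.image x).orderEmbOfCardLe hcard).strictMono

lemma affine_pos_of_neg_of_nonneg {m c t₁ t₂ t₃ : ℝ} (h₁₂ : t₁ < t₂) (h₂₃ : t₂ < t₃)
    (h₁ : m * t₁ + c < 0) (h₂ : 0 ≤ m * t₂ + c) : 0 < m * t₃ + c := by
  have hm : 0 < m := pos_of_mul_pos_left (b := t₂ - t₁) (by linarith) (by linarith)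
  nlinarith [mul_pos hm (sub_pos.2 h₂₃)]

lemma exists_bisecting_line_through {l : ℝ × ℝ} {R : Finset (ℝ × ℝ)} {k : ℕ}
    (hl : ∀ b ∈ R, l.1 < b.1) (hR : 2 * k + 1 ≤ #R) :
    ∃ m c : ℝ, m * l.1 + c = l.2 ∧ k + 1 ≤ #{b ∈ R | m * b.1 + c ≤ b.2} ∧
      k + 1 ≤ #{b ∈ R | b.2 ≤ m * b.1 + c} := by
  obtain ⟨r, -, hle, hge⟩ := exists_weak_median (fun b => (b.2 - l.2) / (b.1 - l.1)) hR
  set m := (r.2 - l.2) / (r.1 - l.1)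
  refine ⟨m, l.2 - m * l.1, by ring, hge.trans_eq ?_, hle.trans_eq ?_⟩ <;>
    refine congrArg _ (filter_congr fun b hb => ?_)
  · rw [le_div_iff₀ (sub_pos.2 (hl b hb))]
    constructor <;> intro h <;> linarith
  · rw [div_le_iff₀ (sub_pos.2 (hl b hb))]
    constructor <;> intro h <;> linarith

lemma exists_bisecting_line {L R : Finset (ℝ × ℝ)} {k : ℕ} {ξ : ℝ} (hL : ∀ a ∈ L, a.1 < ξ)
    (hR : ∀ b ∈ R, ξ < b.1) (hLk : 2 * k + 1 ≤ #L) (hRk : #R = 2 * k + 1) :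
    ∃ m c : ℝ, k + 1 ≤ #{a ∈ L | m * a.1 + c ≤ a.2} ∧ k + 1 ≤ #{a ∈ L | a.2 ≤ m * a.1 + c} ∧
      k + 1 ≤ #{b ∈ R | m * b.1 + c ≤ b.2} ∧ k + 1 ≤ #{b ∈ R | b.2 ≤ m * b.1 + c} := by
  classical
  have hlines : ∀ l ∈ L, ∃ m c : ℝ, m * l.1 + c = l.2 ∧
      k + 1 ≤ #{b ∈ R | m * b.1 + c ≤ b.2} ∧ k + 1 ≤ #{b ∈ R | b.2 ≤ m * b.1 + c} :=
    fun l hl => exists_bisecting_line_through (fun b hb => (hL l hl).trans (hR b hb)) hRk.ge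
  choose! m c hmc hup hdown using hlines
  -- Two bisectors of `R` cannot be ordered strictly over all of `R`, so the one that is at most the
  -- other at `ξ` is also at most the other to the left of `ξ`.
  have hle : ∀ a ∈ L, ∀ a' ∈ L, m a * ξ + c a ≤ m a' * ξ + c a' →
      ∀ t < ξ, m a' * t + c a' < m a * t + c a → False := by
    intro a ha a' ha' hξ t ht hlt
    obtain ⟨b, hb⟩ := inter_nonempty_of_card_lt_card_add_card
      (filter_subset (fun b => m a' * b.1 + c a' ≤ b.2) R)
      (filter_subset (fun b => b.2 ≤ m a * b.1 + c a) R)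
      (by linarith [hup a' ha', hdown a ha])
    simp only [mem_inter, mem_filter] at hb
    have := affine_pos_of_neg_of_nonneg (m := m a' - m a) (c := c a' - c a) ht (hR b hb.1.1)
      (by linarith) (by linarith)
    linarith [hb.1.2, hb.2.2]
  obtain ⟨l, hl, hbelow, habove⟩ := exists_weak_median (fun l => m l * ξ + c l) hLk
  refine ⟨m l, c l, habove.trans (card_le_card ?_), hbelow.trans (card_le_card ?_), hup l hl,
    hdown l hl⟩
  · refine monotone_filter_right L fun a ha hξ => not_lt.1 fun hlt => ?_
    exact hle l hl a ha hξ a.1 (hL a ha) (by linarith [hmc a ha])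
  · refine monotone_filter_right L fun a ha hξ => not_lt.1 fun hlt => ?_
    exact hle a ha l hl hξ a.1 (hL a ha) (by linarith [hmc a ha])

/-- Twice the signed area of the triangle `p q r`. -/
def orient (p q r : ℝ × ℝ) : ℝ :=
  (q.1 - p.1) * (r.2 - p.2) - (q.2 - p.2) * (r.1 - p.1)

lemma orient_eq_slope_sub_mul {a b o : ℝ × ℝ} (ha : a.1 ≠ o.1) (hb : b.1 ≠ o.1) :
    orient a b o = ((o.2 - b.2) / (o.1 - b.1) - (o.2 - a.2) / (o.1 - a.1)) *
      ((o.1 - a.1) * (o.1 - b.1)) := by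
  have := sub_ne_zero.2 ha.symm
  have := sub_ne_zero.2 hb.symm
  unfold orient
  field_simp
  ring

section Sign

/-! The sign `ε` stands for a possible reflection in the first coordinate axis. -/

variable {ε : ℝ}

lemma exists_subset_orient_sign (ε : ℝ) {S : Finset (ℝ × ℝ)} {o : ℝ × ℝ} {m : ℕ}
    (ho : (∀ a ∈ S, a.1 < o.1) ∨ ∀ a ∈ S, o.1 < a.1) (hS : m ^ 2 ≤ #S) :
    ∃ T ⊆ S, m ≤ #T ∧ ((∀ a ∈ T, ∀ b ∈ T, a.1 < b.1 → 0 < ε * orient a b o) ∨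
      ∀ a ∈ T, ∀ b ∈ T, a.1 < b.1 → ε * orient a b o ≤ 0) := by
  have hne : ∀ a ∈ S, a.1 ≠ o.1 := fun a ha => ho.elim (fun h => (h a ha).ne) fun h => (h a ha).ne'
  have hpos : ∀ a ∈ S, ∀ b ∈ S, 0 < (o.1 - a.1) * (o.1 - b.1) := by
    intro a ha b hb
    rcases ho with h | h
    · exact mul_pos (sub_pos.2 (h a ha)) (sub_pos.2 (h b hb))
    · exact mul_pos_of_neg_of_neg (sub_neg.2 (h a ha)) (sub_neg.2 (h b hb))
  obtain ⟨T, hT, hmT, hmono⟩ := exists_strictMono_or_antitone_of_sq_le_card Prod.fst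
    (fun a => ε * ((o.2 - a.2) / (o.1 - a.1))) m S hS
  refine ⟨T, hT, hmT, hmono.imp (fun h a ha b hb hab => ?_) fun h a ha b hb hab => ?_⟩ <;>
    rw [orient_eq_slope_sub_mul (hne a (hT ha)) (hne b (hT hb)), ← mul_assoc, mul_sub]
  · exact mul_pos (sub_pos.2 (h a ha b hb hab)) (hpos a (hT ha) b (hT hb))
  · exact mul_nonpos_of_nonpos_of_nonneg (sub_nonpos.2 (h a ha b hb hab))
      (hpos a (hT ha) b (hT hb)).le

lemma orient_pos_of_above {a a' b : ℝ × ℝ} {μ ν ξ : ℝ} (haa' : a.1 < a'.1) (haξ : a.1 < ξ)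
    (hξb : ξ < b.1) (ha : 0 ≤ ε * (a.2 - (μ * a.1 + ν))) (hb : 0 ≤ ε * (b.2 - (μ * b.1 + ν)))
    (ho : 0 < ε * orient a a' (ξ, μ * ξ + ν)) : 0 < ε * orient a a' b := by
  have key : (ξ - a.1) * (ε * orient a a' b) =
      (ξ - a.1) * (a'.1 - a.1) * (ε * (b.2 - (μ * b.1 + ν))) +
      (b.1 - a.1) * (ε * orient a a' (ξ, μ * ξ + ν)) +
      (b.1 - ξ) * (a'.1 - a.1) * (ε * (a.2 - (μ * a.1 + ν))) := by
    unfold orient; ring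
  rw [← sub_pos] at haa' haξ hξb
  refine pos_of_mul_pos_right (key ▸ ?_) haξ.le
  have := mul_nonneg (mul_pos haξ haa').le hb
  have := mul_nonneg (mul_pos hξb haa').le ha
  have := mul_pos (show 0 < b.1 - a.1 by linarith) ho
  linarith

lemma orient_nonpos_of_below {a a' c : ℝ × ℝ} {μ ν ξ : ℝ} (haa' : a.1 < a'.1) (hac : a.1 < c.1)
    (hcξ : c.1 < ξ) (ha : 0 ≤ ε * (a.2 - (μ * a.1 + ν))) (hc : ε * (c.2 - (μ * c.1 + ν)) ≤ 0)
    (ho : ε * orient a a' (ξ, μ * ξ + ν) ≤ 0) : ε * orient a a' c ≤ 0 := by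
  have key : (ξ - a.1) * -(ε * orient a a' c) =
      (ξ - a.1) * (a'.1 - a.1) * -(ε * (c.2 - (μ * c.1 + ν))) +
      (c.1 - a.1) * -(ε * orient a a' (ξ, μ * ξ + ν)) +
      (ξ - c.1) * (a'.1 - a.1) * (ε * (a.2 - (μ * a.1 + ν))) := by
    unfold orient; ring
  rw [← sub_pos] at haa' hac hcξ
  have haξ : 0 < ξ - a.1 := by linarith
  refine neg_nonneg.1 (nonneg_of_mul_nonneg_right (key ▸ ?_) haξ)
  have := mul_nonneg (mul_pos haξ haa').le (neg_nonneg.2 hc)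
  have := mul_nonneg hac.le (neg_nonneg.2 ho)
  have := mul_nonneg (mul_pos hcξ haa').le ha
  linarith

lemma orient_pos_of_left {a p b b' : ℝ × ℝ} (hap : a.1 < p.1) (hpb : p.1 < b.1)
    (hbb' : b.1 < b'.1) (hapb : 0 < ε * orient a p b) (hbb'p : 0 < ε * orient b b' p) :
    0 < ε * orient b b' a := by
  have key : (b.1 - p.1) * (ε * orient b b' a) =
      (b'.1 - b.1) * (ε * orient a p b) + (b.1 - a.1) * (ε * orient b b' p) := by
    unfold orient; ring
  rw [← sub_pos] at hap hpb hbb'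
  refine pos_of_mul_pos_right (key ▸ ?_) hpb.le
  exact add_pos (mul_pos hbb' hapb) (mul_pos (by linarith) hbb'p)

lemma orient_pos_of_right {a p b b' : ℝ × ℝ} (hpa : p.1 < a.1) (hab : a.1 < b.1)
    (hbb' : b.1 < b'.1) (hpab : 0 < ε * orient p a b) (hbb'p : ε * orient b b' p ≤ 0) :
    0 < ε * orient b' b a := by
  have key : (b.1 - p.1) * (ε * orient b' b a) =
      (b'.1 - b.1) * (ε * orient p a b) + (b.1 - a.1) * -(ε * orient b b' p) := by
    unfold orient; ring
  rw [← sub_pos] at hpa hab hbb'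
  refine pos_of_mul_pos_right (key ▸ ?_) (show 0 ≤ b.1 - p.1 by linarith)
  exact add_pos_of_pos_of_nonneg (mul_pos hbb' hpab) (mul_nonneg hab.le (neg_nonneg.2 hbb'p))

/-- Two mutually avoiding sequences separated by a vertical line: no line through two points of one
sequence separates the other. The enumerations are such that the segments `a i b i` cross
pairwise. -/
structure MutuallyAvoiding (ε : ℝ) {k : ℕ} (a b : Fin k → ℝ × ℝ) : Prop where
  fst_lt : ∀ i j, (a i).1 < (b j).1
  left : ∀ i j l, i < j → 0 < ε * orient (a i) (a j) (b l)
  right : ∀ i j l, i < j → 0 < ε * orient (b i) (b j) (a l)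

lemma exists_mutuallyAvoiding_of_orient_pos {A B : Finset (ℝ × ℝ)} {k : ℕ}
    (hA : Set.InjOn Prod.fst (A : Set (ℝ × ℝ))) (hB : Set.InjOn Prod.fst (B : Set (ℝ × ℝ)))
    (hAB : ∀ a ∈ A, ∀ b ∈ B, a.1 < b.1)
    (ho : ∀ a ∈ A, ∀ a' ∈ A, a.1 < a'.1 → ∀ b ∈ B, 0 < ε * orient a a' b)
    (hAk : 2 * k + 1 ≤ #A) (hBk : k ^ 2 ≤ #B) :
    ∃ a b : Fin k → ℝ × ℝ, (∀ i, a i ∈ A) ∧ (∀ i, b i ∈ B) ∧ MutuallyAvoiding ε a b := by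
  obtain ⟨a, haA, ha⟩ := exists_strictMono_enum Prod.fst hA hAk
  let p := a ⟨k, by omega⟩
  have hpA : p ∈ A := haA _
  obtain ⟨B', hB'B, hB'k, hB'⟩ :=
    exists_subset_orient_sign ε (Or.inr fun b hb => hAB p hpA b hb) hBk
  obtain ⟨b, hbB', hb⟩ :=
    exists_strictMono_enum Prod.fst (hB.mono (coe_subset.2 hB'B)) hB'k
  have hbB : ∀ i, b i ∈ B := fun i => hB'B (hbB' i)
  rcases hB' with hB' | hB'
  · let l (i : Fin k) : Fin (2 * k + 1) := ⟨i, by omega⟩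
    have hl_lt (i : Fin k) : (a (l i)).1 < p.1 := ha (by simp [l, Fin.lt_def])
    refine ⟨fun i => a (l i), b, fun i => haA _, hbB, fun i j => hAB _ (haA _) _ (hbB j),
      fun i j n hij => ho _ (haA _) _ (haA _) (ha (Fin.lt_def.2 hij)) _ (hbB n),
      fun i j n hij => ?_⟩
    exact orient_pos_of_left (hl_lt n) (hAB p hpA _ (hbB i)) (hb hij)
      (ho _ (haA _) p hpA (hl_lt n) _ (hbB i)) (hB' _ (hbB' i) _ (hbB' j) (hb hij))
  · let r (i : Fin k) : Fin (2 * k + 1) := ⟨k + 1 + i, by omega⟩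
    have hr_lt (i : Fin k) : p.1 < (a (r i)).1 := ha (by simp only [r, Fin.lt_def]; omega)
    refine ⟨fun i => a (r i), fun i => b i.rev, fun i => haA _, fun i => hbB _,
      fun i j => hAB _ (haA _) _ (hbB _),
      fun i j n hij => ho _ (haA _) _ (haA _) (ha ?_) _ (hbB _), fun i j n hij => ?_⟩
    · simp only [r, Fin.lt_def]
      omega
    have hji := hb (Fin.rev_lt_rev.2 hij)
    exact orient_pos_of_right (hr_lt n) (hAB _ (haA _) _ (hbB _)) hji
      (ho p hpA _ (haA _) (hr_lt n) _ (hbB _)) (hB' _ (hbB' _) _ (hbB' _) hji)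

lemma exists_mutuallyAvoiding_of_bisected {P A B C : Finset (ℝ × ℝ)} {k : ℕ} {μ ν ξ : ℝ}
    (hP : Set.InjOn Prod.fst (P : Set (ℝ × ℝ)))
    (ho : ∀ a ∈ P, ∀ b ∈ P, ∀ c ∈ P, a.1 < b.1 → a.1 < c.1 → b ≠ c → ε * orient a b c ≠ 0)
    (hAP : A ⊆ P) (hBP : B ⊆ P) (hCP : C ⊆ P)
    (hA : ∀ a ∈ A, 0 ≤ ε * (a.2 - (μ * a.1 + ν))) (hB : ∀ b ∈ B, 0 ≤ ε * (b.2 - (μ * b.1 + ν)))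
    (hC : ∀ c ∈ C, ε * (c.2 - (μ * c.1 + ν)) ≤ 0) (hAC : ∀ a ∈ A, ∀ c ∈ C, a.1 < c.1)
    (hAξ : ∀ a ∈ A, a.1 < ξ) (hCξ : ∀ c ∈ C, c.1 < ξ) (hξB : ∀ b ∈ B, ξ < b.1)
    (hAk : (2 * k + 1) ^ 2 ≤ #A) (hBk : k ^ 2 ≤ #B) (hCk : k ^ 2 ≤ #C) :
    ∃ δ, ∃ a b : Fin k → ℝ × ℝ, (∀ i, a i ∈ P) ∧ (∀ i, b i ∈ P) ∧ MutuallyAvoiding δ a b := by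
  obtain ⟨A', hA'A, hA'k, hA'⟩ :=
    exists_subset_orient_sign (o := (ξ, μ * ξ + ν)) ε (Or.inl hAξ) hAk
  have hA'P := hA'A.trans hAP
  rcases hA' with hA' | hA'
  · obtain ⟨a, b, ha, hb, hab⟩ := exists_mutuallyAvoiding_of_orient_pos (hP.mono hA'P)
      (hP.mono hBP) (fun a ha b hb => (hAξ a (hA'A ha)).trans (hξB b hb))
      (fun a ha a' ha' haa' b hb => orient_pos_of_above haa' (hAξ a (hA'A ha)) (hξB b hb)
        (hA a (hA'A ha)) (hB b hb) (hA' a ha a' ha' haa')) hA'k hBk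
    exact ⟨ε, a, b, fun i => hA'P (ha i), fun i => hBP (hb i), hab⟩
  · have hA'C : ∀ a ∈ A', ∀ a' ∈ A', a.1 < a'.1 → ∀ c ∈ C, 0 < -ε * orient a a' c := by
      intro a ha a' ha' haa' c hc
      have hac := hAC a (hA'A ha) c hc
      rw [neg_mul, neg_pos]
      exact (orient_nonpos_of_below haa' hac (hCξ c hc) (hA a (hA'A ha)) (hC c hc)
        (hA' a ha a' ha' haa')).lt_of_ne (ho a (hA'P ha) a' (hA'P ha') c (hCP hc) haa' hac
          (ne_of_apply_ne Prod.fst (hAC a' (hA'A ha') c hc).ne))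
    obtain ⟨a, b, ha, hb, hab⟩ := exists_mutuallyAvoiding_of_orient_pos (hP.mono hA'P)
      (hP.mono hCP) (fun a ha c hc => hAC a (hA'A ha) c hc) hA'C hA'k hCk
    exact ⟨-ε, a, b, fun i => hA'P (ha i), fun i => hCP (hb i), hab⟩

end Sign

lemma exists_vertical_split {S : Finset (ℝ × ℝ)}
    (hS : Set.InjOn Prod.fst (S : Set (ℝ × ℝ))) {i j : ℕ} (hij : i + j ≤ #S) :
    ∃ T ⊆ S, ∃ U ⊆ S, ∃ ξ, #T = i ∧ #U = j ∧ (∀ a ∈ T, a.1 < ξ) ∧ ∀ b ∈ U, ξ < b.1 := by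
  classical
  obtain ⟨T, hTS, hTi, hT⟩ := exists_initial_subset Prod.fst hS (show i ≤ #S by omega)
  obtain ⟨U, hU, hUj⟩ := exists_subset_card_eq
    (show j ≤ #(S \ T) by rw [card_sdiff_of_subset hTS]; omega)
  have hTU : ∀ x ∈ T.image Prod.fst, ∀ y ∈ U.image Prod.fst, x < y := by
    simp only [mem_image, forall_exists_index, and_imp]
    rintro - a ha rfl - b hb rfl
    exact hT a ha b (mem_sdiff.1 (hU hb)).1 (mem_sdiff.1 (hU hb)).2
  obtain ⟨ξ, hTξ, hξU⟩ := Finset.exists_between' _ _ hTU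
  exact ⟨T, hTS, U, hU.trans sdiff_subset, ξ, hTi, hUj,
    fun a ha => hTξ _ (mem_image_of_mem _ ha), fun b hb => hξU _ (mem_image_of_mem _ hb)⟩

lemma exists_mutuallyAvoiding {P : Finset (ℝ × ℝ)} {k m : ℕ}
    (hP : Set.InjOn Prod.fst (P : Set (ℝ × ℝ)))
    (ho : ∀ a ∈ P, ∀ b ∈ P, ∀ c ∈ P, a.1 < b.1 → a.1 < c.1 → b ≠ c → orient a b c ≠ 0)
    (hk : (2 * k + 1) ^ 2 ≤ m + 1) (hm : 6 * m + 3 ≤ #P) :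
    ∃ ε, ∃ a b : Fin k → ℝ × ℝ, (∀ i, a i ∈ P) ∧ (∀ i, b i ∈ P) ∧ MutuallyAvoiding ε a b := by
  obtain ⟨LM, hLM, R, hRP, ξ, hLMm, hRm, hLMξ, hξR⟩ :=
    exists_vertical_split hP (i := 4 * m + 2) (j := 2 * m + 1) (by omega)
  obtain ⟨L, hL, M, hM, η, hLm, hMm, hLη, hηM⟩ :=
    exists_vertical_split (hP.mono hLM) (i := 2 * m + 1) (j := 2 * m + 1) (by omega)
  have hLP := hL.trans hLM
  have hMP := hM.trans hLM
  obtain ⟨μ, ν, hL_up, hL_down, hR_up, hR_down⟩ :=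
    exists_bisecting_line (fun a ha => hLMξ a (hL ha)) hξR hLm.ge hRm
  obtain ⟨ε, hε, hLε, hRε, hMε⟩ : ∃ ε : ℝ, ε ≠ 0 ∧
      m + 1 ≤ #{a ∈ L | 0 ≤ ε * (a.2 - (μ * a.1 + ν))} ∧
      m + 1 ≤ #{b ∈ R | 0 ≤ ε * (b.2 - (μ * b.1 + ν))} ∧
      m + 1 ≤ #{c ∈ M | ε * (c.2 - (μ * c.1 + ν)) ≤ 0} := by
    by_cases hM_down : m + 1 ≤ #{c ∈ M | c.2 ≤ μ * c.1 + ν}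
    · refine ⟨1, one_ne_zero, ?_⟩
      simpa only [one_mul, sub_nonneg, sub_nonpos] using ⟨hL_up, hR_up, hM_down⟩
    · have hM_up : m + 1 ≤ #{c ∈ M | μ * c.1 + ν ≤ c.2} := by
        have := card_filter_add_card_filter_not (s := M) (fun c => c.2 ≤ μ * c.1 + ν)
        have := card_le_card (monotone_filter_right M fun c _ (h : ¬ c.2 ≤ μ * c.1 + ν) =>
          (not_le.1 h).le)
        omega
      refine ⟨-1, by norm_num, ?_⟩
      simpa only [neg_one_mul, neg_nonneg, neg_nonpos, sub_nonneg, sub_nonpos] using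
        ⟨hL_down, hR_down, hM_up⟩
  have hkm : k ^ 2 ≤ m + 1 := by nlinarith
  refine exists_mutuallyAvoiding_of_bisected hP
    (fun a ha b hb c hc hab hac hbc => mul_ne_zero hε (ho a ha b hb c hc hab hac hbc))
    ((filter_subset _ L).trans hLP) ((filter_subset _ R).trans hRP) ((filter_subset _ M).trans hMP)
    (fun a ha => (mem_filter.1 ha).2) (fun b hb => (mem_filter.1 hb).2)
    (fun c hc => (mem_filter.1 hc).2) (fun a ha c hc => ?_)
    (fun a ha => hLMξ a (hL (mem_filter.1 ha).1)) (fun c hc => hLMξ c (hM (mem_filter.1 hc).1))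
    (fun b hb => hξR b (mem_filter.1 hb).1) (hk.trans hLε) (hkm.trans hRε) (hkm.trans hMε)
  exact (hLη a (mem_filter.1 ha).1).trans (hηM c (mem_filter.1 hc).1)

lemma conesCross_homogenize_of_orient [DecidableEq α] {p : α → ℝ × ℝ} {ε : ℝ} {a b a' b' : α}
    (hab : a ≠ b) (hab' : a' ≠ b') (haa' : a ≠ a') (ha_b' : a ≠ b') (hb_a' : b ≠ a')
    (hbb' : b ≠ b')
    (h₁ : 0 < ε * orient (p a) (p a') (p b)) (h₂ : 0 < ε * orient (p a) (p a') (p b'))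
    (h₃ : 0 < ε * orient (p b) (p b') (p a)) (h₄ : 0 < ε * orient (p b) (p b') (p a')) :
    ConesCross (homogenize p) {a, b} {a', b'} := by
  -- the weights are given by Cramer's rule
  let w : α → ℝ := fun i =>
    if i = a then ε * orient (p b) (p b') (p a') else
    if i = a' then ε * orient (p b) (p b') (p a) else
    if i = b then ε * orient (p a) (p a') (p b') else ε * orient (p a) (p a') (p b)
  have hw : ∀ i, 0 < w i := by
    intro i
    simp only [w]
    split_ifs <;> assumption
  refine ⟨w, fun i _ => hw i, fun i _ => hw i, ?_⟩
  rw [sum_pair hab, sum_pair hab']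
  simp only [w, if_true, if_neg hab.symm, if_neg hb_a', if_neg haa'.symm, if_neg ha_b'.symm,
    if_neg hab'.symm, if_neg hbb'.symm, homogenize, Prod.smul_mk, smul_eq_mul, Prod.mk_add_mk]
  refine Prod.ext (Prod.ext ?_ ?_) ?_ <;> simp only [orient, Prod.fst_add, Prod.snd_add,
    Prod.smul_fst, Prod.smul_snd, smul_eq_mul] <;> ring

lemma MutuallyAvoiding.exists_isConeFamily {p : α → ℝ × ℝ} {P : Finset α} {ε : ℝ} {k : ℕ}
    {a b : Fin k → α} (ha : ∀ i, a i ∈ P) (hb : ∀ i, b i ∈ P)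
    (hab : MutuallyAvoiding ε (fun i => p (a i)) fun i => p (b i)) :
    ∃ F, IsConeFamily (homogenize p) P 2 F ∧ #F = k := by
  classical
  have hne : ∀ i j, a i ≠ b j := fun i j h =>
    (hab.fst_lt i j).ne (congrArg (fun x => (p x).1) h)
  have ha_inj : ∀ i j, i < j → a i ≠ a j := fun i j hij h => by
    simpa [h, orient] using hab.left i j i hij
  have hb_inj : ∀ i j, i < j → b i ≠ b j := fun i j hij h => by
    simpa [h, orient] using hab.right i j i hij
  have hlt : ∀ i j, i < j → Disjoint ({a i, b i} : Finset α) {a j, b j} ∧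
      ConesCross (homogenize p) {a i, b i} {a j, b j} := fun i j hij =>
    ⟨by simp [hne, (hne _ _).symm, (ha_inj i j hij).symm, (hb_inj i j hij).symm],
      conesCross_homogenize_of_orient (hne i i) (hne j j) (ha_inj i j hij) (hne i j)
        (hne j i).symm (hb_inj i j hij) (hab.left i j i hij) (hab.left i j j hij)
        (hab.right i j i hij) (hab.right i j j hij)⟩
  obtain ⟨F, hF, hF_card⟩ := exists_isConeFamily_of_pairwise (u := homogenize p) (P := P) two_pos
    (I := univ) (f := fun i => {a i, b i}) (by simp [insert_subset_iff, ha, hb])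
    (by simp [card_pair (hne _ _)]) fun i _ j _ hij =>
      hij.lt_or_gt.elim (hlt i j) fun h => ⟨(hlt j i h).1.symm, (hlt j i h).2.symm⟩
  exact ⟨F, hF, hF_card.trans (card_fin k)⟩

lemma IsGeneric.orient_ne_zero {p : α → ℝ × ℝ} {P : Finset α} (h : IsGeneric (homogenize p) P)
    {a b c : α} (ha : a ∈ P) (hb : b ∈ P) (hc : c ∈ P) (hab : (p a).1 ≠ (p b).1) (hac : a ≠ c)
    (hbc : b ≠ c) : orient (p a) (p b) (p c) ≠ 0 := by
  classical
  intro h0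
  have hab' : a ≠ b := by rintro rfl; exact hab rfl
  have hli := h {a, b, c} (by simp [insert_subset_iff, ha, hb, hc])
    (card_le_three.trans (by simp))
  rw [linearIndepOn_finset_iff] at hli
  simp only [orient] at h0
  have := hli (fun i => if i = a then (p c).1 - (p b).1 else if i = b then (p a).1 - (p c).1
    else (p b).1 - (p a).1) (by
      rw [sum_insert (by simp [hab', hac]), sum_pair hbc]
      simp only [if_true, if_neg hab'.symm, if_neg hac.symm, if_neg hbc.symm, homogenize,
        Prod.smul_mk, smul_eq_mul, Prod.mk_add_mk]
      refine Prod.ext (Prod.ext ?_ ?_) ?_ <;> simp only [Prod.fst_add, Prod.snd_add,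
        Prod.smul_fst, Prod.smul_snd, smul_eq_mul, Prod.fst_zero, Prod.snd_zero]
      · ring
      · linarith
      · ring) c (by simp)
  rw [if_neg hac.symm, if_neg hbc.symm, sub_eq_zero] at this
  exact hab this.symm

lemma exists_isConeFamily_real_prod {p : α → ℝ × ℝ} {P : Finset α} {k m : ℕ}
    (h : IsGeneric (homogenize p) P) (hp : Set.InjOn (fun i => (p i).1) (P : Set α))
    (hk : (2 * k + 1) ^ 2 ≤ m + 1) (hm : 6 * m + 3 ≤ #P) :
    ∃ F, IsConeFamily (homogenize p) P 2 F ∧ #F = k := by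
  classical
  obtain ⟨ε, a, b, ha, hb, hab⟩ := exists_mutuallyAvoiding (P := P.image p) (k := k) (m := m)
    (by
      simp only [coe_image]
      rintro - ⟨i, hi, rfl⟩ - ⟨j, hj, rfl⟩ hij
      rw [hp hi hj hij])
    (by
      simp only [mem_image]
      rintro - ⟨i, hi, rfl⟩ - ⟨j, hj, rfl⟩ - ⟨l, hl, rfl⟩ hij hil hjl
      exact h.orient_ne_zero hi hj hl hij.ne (by rintro rfl; exact hil.ne rfl)
        (by rintro rfl; exact hjl rfl)) hk
    (by rwa [card_image_of_injOn (Set.InjOn.of_comp (g := Prod.fst) hp)])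
  simp only [mem_image] at ha hb
  choose a' ha' hpa using ha
  choose b' hb' hpb using hb
  exact MutuallyAvoiding.exists_isConeFamily (ε := ε) ha' hb' (by simpa only [hpa, hpb] using hab)

lemma exists_sqrt_le_mul {n : ℕ} (hn : 2 < n) :
    ∃ k m : ℕ, (k = 1 ∨ (2 * k + 1) ^ 2 ≤ m + 1) ∧ 6 * m + 3 ≤ n ∧ √(n : ℝ) ≤ 15 * k := by
  obtain ⟨m, hmn, hnm⟩ : ∃ m, 6 * m + 3 ≤ n ∧ n < 6 * m + 9 := ⟨(n - 3) / 6, by omega, by omega⟩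
  have hq_le : Nat.sqrt (m + 1) ^ 2 ≤ m + 1 := Nat.sqrt_le' _
  have hq_lt : m + 1 < (Nat.sqrt (m + 1) + 1) ^ 2 := Nat.lt_succ_sqrt' _
  set q := Nat.sqrt (m + 1)
  suffices h : ∃ k, (k = 1 ∨ 2 * k + 1 ≤ q) ∧ q + 1 ≤ 5 * k by
    obtain ⟨k, hk, hqk⟩ := h
    refine ⟨k, m, hk.imp_right fun h => (Nat.pow_le_pow_left h 2).trans hq_le, hmn, ?_⟩
    have hnk : n ≤ (15 * k) ^ 2 := by nlinarith [Nat.pow_le_pow_left hqk 2]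
    rw [Real.sqrt_le_left (by positivity)]
    exact_mod_cast hnk
  by_cases hq : 3 ≤ q
  · exact ⟨(q - 1) / 2, Or.inr (by omega), by omega⟩
  · exact ⟨1, Or.inl rfl, by omega⟩

theorem exists_isConeFamily_of_finrank_eq_two {V : Type*} [AddCommGroup V] [Module ℝ V]
    (hV : finrank ℝ V = 2) {v : α → V} {P : Finset α} (h : IsGeneric (homogenize v) P)
    (hP : 2 < #P) : ∃ F, IsConeFamily (homogenize v) P 2 F ∧ √(#P : ℝ) ≤ 15 * #F := by
  have : FiniteDimensional ℝ V := FiniteDimensional.of_finrank_pos (by omega)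
  obtain ⟨φ, hφ⟩ := exists_dual_injOn (h.injOn_of_homogenize (by omega))
  have hφ0 : φ ≠ 0 := by
    rintro rfl
    obtain ⟨a, ha, b, hb, hab⟩ := one_lt_card.1 (by omega : 1 < #P)
    exact hab (hφ ha hb rfl)
  obtain ⟨e', he'⟩ := exists_linearEquiv_prod (V := ℝ) (by rw [hV, finrank_self]) hφ0
  let e := e'.trans (LinearEquiv.prodComm ℝ ℝ ℝ)
  have he : ∀ x, (e x).1 = φ x := he'
  obtain ⟨k, m, hk | hk, hm, hkP⟩ := exists_sqrt_le_mul hP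
  · obtain ⟨s, hs, hs2⟩ := exists_subset_card_eq (show 2 ≤ #P by omega)
    exact ⟨{s}, hs2 ▸ IsConeFamily.singleton _ hs, by simpa [hk] using hkP⟩
  · obtain ⟨F, hF, rfl⟩ := exists_isConeFamily_real_prod ((isGeneric_homogenize_map_iff e).2 h)
      (by simpa only [he] using hφ) hk hm
    exact ⟨F, (isConeFamily_homogenize_map_iff e).1 hF, hkP⟩

end Planar

section Crossing

variable {E : Type*} [AddCommGroup E] [Module ℝ E]

lemma exists_dual_pos_of_forall_sum_eq_zero (a : α → E) (T : Finset α)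
    (h : ∀ w : α → ℝ, (∀ i ∈ T, 0 ≤ w i) → ∑ i ∈ T, w i • a i = 0 → ∀ i ∈ T, w i = 0) :
    ∃ g : Dual ℝ E, ∀ i ∈ T, 0 < g (a i) := by
  classical
  let L : (T → ℝ) →ₗ[ℝ] E := Fintype.linearCombination ℝ fun i : T => a i
  have hdisj : Disjoint (stdSimplex ℝ T) (LinearMap.ker L : Set (T → ℝ)) := by
    refine Set.disjoint_left.2 fun w hw hLw => zero_ne_one (α := ℝ) ?_
    have hw0 := h (fun i => if hi : i ∈ T then w ⟨i, hi⟩ else 0)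
      (fun i hi => by simpa only [dif_pos hi] using hw.1 ⟨i, hi⟩)
      (by
        rw [← (LinearMap.mem_ker.1 hLw : L w = 0), ← sum_coe_sort T]
        exact sum_congr rfl fun i _ => by rw [dif_pos i.2])
    rw [← hw.2, sum_eq_zero fun i _ => by simpa using hw0 i i.2]
  obtain ⟨f, c, c', hf, hcc', hker⟩ := geometric_hahn_banach_compact_closed
    (convex_stdSimplex ℝ T) (isCompact_stdSimplex ℝ T) (LinearMap.ker L).convex
    (LinearMap.ker L).closed_of_finiteDimensional hdisj
  have hc' : c' < 0 := by simpa using hker 0 (zero_mem _)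
  have hf_ker : ∀ x ∈ LinearMap.ker L, f x = 0 := by
    intro x hx
    by_contra hne
    have := hker ((c' / f x) • x) (Submodule.smul_mem _ _ hx)
    rw [map_smul, smul_eq_mul, div_mul_cancel₀ _ hne] at this
    exact this.false
  obtain ⟨g, hg⟩ : f.toLinearMap ∈ LinearMap.range L.dualMap := by
    rw [LinearMap.range_dualMap_eq_dualAnnihilator_ker, Submodule.mem_dualAnnihilator]
    exact hf_ker
  refine ⟨-g, fun i hi => ?_⟩
  have hgi : g (a i) = f (Pi.single ⟨i, hi⟩ 1) := by
    have := LinearMap.congr_fun hg (Pi.single ⟨i, hi⟩ 1)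
    rwa [LinearMap.dualMap_apply, Fintype.linearCombination_apply_single, one_smul] at this
  have := hf _ (single_mem_stdSimplex ℝ (⟨i, hi⟩ : T))
  rw [LinearMap.neg_apply, hgi]
  linarith

lemma IsGeneric.smul {u : α → E} {r : α → ℝ} {P : Finset α} (hr : ∀ i ∈ P, r i ≠ 0)
    (h : IsGeneric u P) : IsGeneric (fun i => r i • u i) P := by
  intro S hS hSE
  exact (h S hS hSE).units_smul fun i : S => Units.mk0 (r i) (hr i (hS i.2))

lemma IsGeneric.span_eq_top [FiniteDimensional ℝ E] {u : α → E} {P : Finset α}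
    (h : IsGeneric u P) (hP : finrank ℝ E ≤ #P) :
    Submodule.span ℝ (u '' (P : Set α)) = ⊤ := by
  obtain ⟨D, hDP, hD⟩ := exists_subset_card_eq hP
  have hli : LinearIndependent ℝ fun i : D => u i := h D hDP hD.le
  refine top_unique ?_
  rw [← hli.span_eq_top_of_card_eq_finrank' (by rw [Fintype.card_coe, hD]), Set.range_comp' u,
    Subtype.range_coe]
  exact Submodule.span_mono (Set.image_mono hDP)

lemma eventually_forall_pos {T : Finset α} {w : α → ℝ} (hw : ∀ i ∈ T, 0 < w i) (η : α → ℝ) :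
    ∀ᶠ ε in nhds (0 : ℝ), ∀ i ∈ T, 0 < w i + ε * η i := by
  refine (Filter.eventually_all_finset T).2 fun i hi => ?_
  have hcont : Continuous fun ε : ℝ => w i + ε * η i := by fun_prop
  exact hcont.continuousAt.eventually (lt_mem_nhds (by simpa using hw i hi))

lemma exists_pos_combination_eq {a : α → E} {T : Finset α} {w : α → ℝ} (hw : ∀ i ∈ T, 0 ≤ w i)
    (hspan : Submodule.span ℝ (a '' ({i ∈ T | 0 < w i} : Finset α)) = ⊤) :
    ∃ w' : α → ℝ, (∀ i ∈ T, 0 < w' i) ∧ ∑ i ∈ T, w' i • a i = ∑ i ∈ T, w i • a i := by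
  classical
  let T' := {i ∈ T | 0 < w i}
  -- raise the vanishing weights to `ε`, and compensate on `T'`
  obtain ⟨η, hη⟩ := Submodule.mem_span_image_finset_iff_exists_fun' ℝ |>.1
    (hspan ▸ Submodule.mem_top : ∑ i ∈ T with ¬ 0 < w i, a i ∈ Submodule.span ℝ (a '' T'))
  obtain ⟨ε, hε, hε0⟩ := (((eventually_forall_pos (T := T') (fun i hi => (mem_filter.1 hi).2)
    (fun i => -η i)).filter_mono nhdsWithin_le_nhds).and
      (self_mem_nhdsWithin (s := Set.Ioi (0 : ℝ)))).exists
  refine ⟨fun i => if 0 < w i then w i + ε * -η i else ε, fun i hi => ?_, ?_⟩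
  · dsimp only
    split_ifs with h
    · exact hε i (mem_filter.2 ⟨hi, h⟩)
    · exact hε0
  · have hzero : ∑ i ∈ T with ¬ 0 < w i, w i • a i = 0 := sum_eq_zero fun i hi => by
      rw [le_antisymm (not_lt.1 (mem_filter.1 hi).2) (hw i (mem_filter.1 hi).1), zero_smul]
    simp only [ite_smul]
    rw [sum_ite, ← smul_sum, ← hη, ← sum_filter_add_sum_filter_not T (fun i => 0 < w i), hzero]
    simp only [add_smul, mul_smul, neg_smul, smul_neg, sum_add_distrib, sum_neg_distrib, ← smul_sum]
    exact (neg_add_cancel_right _ _).trans (add_zero _).symm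

lemma IsGeneric.exists_pos_dependence_or_dual_pos [FiniteDimensional ℝ E] {a : α → E}
    {T : Finset α} (h : IsGeneric a T) :
    (∃ w : α → ℝ, (∀ i ∈ T, 0 < w i) ∧ ∑ i ∈ T, w i • a i = 0) ∨
      ∃ g : Dual ℝ E, ∀ i ∈ T, 0 < g (a i) := by
  by_contra! hcon
  obtain ⟨hpos, hdual⟩ := hcon
  refine (exists_dual_pos_of_forall_sum_eq_zero a T fun w hw hsum => ?_).elim fun g hg =>
    let ⟨i, hi, hgi⟩ := hdual g
    hgi.not_gt (hg i hi)
  have hsum' : ∑ i ∈ T with 0 < w i, w i • a i = 0 := by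
    rw [← hsum]
    refine sum_filter_of_ne fun i hi hne => (hw i hi).lt_of_ne' ?_
    rintro h0
    exact hne (by rw [h0, zero_smul])
  have hcard : #{i ∈ T | 0 < w i} ≤ finrank ℝ E := by
    by_contra! hlt
    obtain ⟨w', hw', hw'sum⟩ := exists_pos_combination_eq hw
      (by simpa using (h.mono (filter_subset (fun i => 0 < w i) T)).span_eq_top hlt.le)
    exact hpos w' hw' (hw'sum.trans hsum)
  intro i hi
  by_contra hne
  exact hne (linearIndepOn_finset_iff.1 (h _ (filter_subset _ _) hcard) w hsum' i
    (mem_filter.2 ⟨hi, (hw i hi).lt_of_ne' hne⟩))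

section Signed

variable [DecidableEq α]

/-- The configuration `u` with the vectors outside `s` reversed, so that the cones over `s` and over
a disjoint set `t` cross exactly if there is a positive dependence on `s ∪ t`. -/
def reverseOutside (s : Finset α) (u : α → E) (i : α) : E := (if i ∈ s then 1 else -1 : ℝ) • u i

lemma sum_union_smul_reverseOutside {s t : Finset α} (hst : Disjoint s t) (w : α → ℝ)
    (u : α → E) :
    ∑ i ∈ s ∪ t, w i • reverseOutside s u i = ∑ i ∈ s, w i • u i - ∑ i ∈ t, w i • u i := by
  rw [sum_union hst, sub_eq_add_neg, ← sum_neg_distrib]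
  congr 1
  · exact sum_congr rfl fun i hi => by rw [reverseOutside, if_pos hi, one_smul]
  · exact sum_congr rfl fun i hi => by
      rw [reverseOutside, if_neg (disjoint_right.1 hst hi), neg_one_smul, smul_neg]

lemma isGeneric_reverseOutside {u : α → E} {P : Finset α} (s : Finset α) (h : IsGeneric u P) :
    IsGeneric (reverseOutside s u) P :=
  h.smul fun i _ => by split_ifs <;> norm_num

lemma IsGeneric.conesCross_or_separated [FiniteDimensional ℝ E] {u : α → E} {s t : Finset α}
    (hst : Disjoint s t) (h : IsGeneric u (s ∪ t)) :
    ConesCross u s t ∨ ∃ g : Dual ℝ E, (∀ i ∈ s, 0 < g (u i)) ∧ ∀ i ∈ t, g (u i) < 0 := by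
  rcases (isGeneric_reverseOutside s h).exists_pos_dependence_or_dual_pos with
    ⟨w, hw, hsum⟩ | ⟨g, hg⟩
  · rw [sum_union_smul_reverseOutside hst, sub_eq_zero] at hsum
    exact Or.inl ⟨w, fun i hi => hw i (mem_union_left t hi),
      fun i hi => hw i (mem_union_right s hi), hsum⟩
  · refine Or.inr ⟨g, fun i hi => ?_, fun i hi => ?_⟩
    · simpa only [reverseOutside, if_pos hi, one_smul] using hg i (mem_union_left t hi)
    · simpa only [reverseOutside, if_neg (disjoint_right.1 hst hi), neg_one_smul, map_neg,
        neg_pos] using hg i (mem_union_right s hi)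

end Signed

/-- The contraction of a vector configuration: its image modulo the line through `z`. For
homogenized points, this is the central projection from the point `z`. -/
def contract (z : E) (u : α → E) (i : α) : E ⧸ (ℝ ∙ z) := (ℝ ∙ z).mkQ (u i)

lemma isGeneric_contract [FiniteDimensional ℝ E] {z : E} {u : α → E} {A : Finset α}
    (h : IsGeneric u A)
    (hz : ∀ D ⊆ A, #D < finrank ℝ E → z ∉ Submodule.span ℝ (u '' (D : Set α))) :
    IsGeneric (contract z u) A := by
  intro D hD hDE
  rcases D.eq_empty_or_nonempty with rfl | hDne
  · simp
  have hE : 0 < finrank ℝ E :=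
    (hDne.card_pos.trans_le hDE).trans_le (Submodule.finrank_quotient_le _)
  have hz0 : z ≠ 0 := by
    rintro rfl
    exact hz ∅ (empty_subset A) (by simpa using hE) (zero_mem _)
  have hfinrank := (ℝ ∙ z).finrank_quotient_add_finrank
  rw [finrank_span_singleton hz0] at hfinrank
  refine (h D hD (by omega)).map (f := (ℝ ∙ z).mkQ) ?_
  rw [Submodule.ker_mkQ, ← Set.image_eq_range]
  exact Submodule.disjoint_span_singleton_of_notMem (hz D hD (by omega))

lemma isGeneric_contract_of_insert [DecidableEq α] [FiniteDimensional ℝ E] {u : α → E}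
    {A : Finset α} {b : α} (hb : b ∉ A) (h : IsGeneric u (insert b A)) :
    IsGeneric (contract (u b) u) A := by
  refine isGeneric_contract (h.mono (subset_insert b A)) fun D hD hDE => ?_
  have hbD : b ∉ D := fun hbD => hb (hD hbD)
  have := h (insert b D) (insert_subset_insert b hD) (by rwa [card_insert_of_notMem hbD])
  rw [coe_insert] at this
  exact this.notMem_span_of_insert hbD

lemma conesCross_contract_iff {z : E} {u : α → E} {s t : Finset α} :
    ConesCross (contract z u) s t ↔ ∃ w : α → ℝ, (∀ i ∈ s, 0 < w i) ∧ (∀ i ∈ t, 0 < w i) ∧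
      ∃ c : ℝ, c • z = ∑ i ∈ s, w i • u i - ∑ i ∈ t, w i • u i := by
  simp only [ConesCross, contract, ← map_smul, ← map_sum]
  simp only [Submodule.mkQ_apply, Submodule.Quotient.eq, Submodule.mem_span_singleton]

lemma not_conesCross_contract {z : E} {u : α → E} {s t : Finset α} (hs : s.Nonempty)
    {g : Dual ℝ E} (hz : g z = 0) (hgs : ∀ i ∈ s, 0 < g (u i)) (hgt : ∀ i ∈ t, g (u i) < 0) :
    ¬ ConesCross (contract z u) s t := by
  rw [conesCross_contract_iff]
  rintro ⟨w, hws, hwt, c, hc⟩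
  have hg := congrArg g hc
  simp only [map_smul, map_sub, map_sum, smul_eq_mul, hz, mul_zero] at hg
  have hs_pos : 0 < ∑ i ∈ s, w i * g (u i) :=
    sum_pos (fun i hi => mul_pos (hws i hi) (hgs i hi)) hs
  have ht_nonpos : ∑ i ∈ t, w i * g (u i) ≤ 0 :=
    sum_nonpos fun i hi => (mul_neg_of_pos_of_neg (hwt i hi) (hgt i hi)).le
  linarith

section Persistence

variable {u : α → E} {s t : Finset α} (x y : E)

lemma isOpen_setOf_conesCross_contract [DecidableEq α] (hst : Disjoint s t)
    (hspan : Submodule.span ℝ (reverseOutside s u '' (s ∪ t : Finset α)) = ⊤) :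
    IsOpen {τ : ℝ | ConesCross (contract (x + τ • y) u) s t} := by
  rw [isOpen_iff_mem_nhds]
  intro τ hτ
  obtain ⟨w, hws, hwt, c, hc⟩ := conesCross_contract_iff.1 hτ
  obtain ⟨η, hη⟩ := Submodule.mem_span_image_finset_iff_exists_fun' ℝ |>.1
    (hspan ▸ Submodule.mem_top : y ∈ Submodule.span ℝ (reverseOutside s u '' (s ∪ t : Finset α)))
  have hw : ∀ i ∈ s ∪ t, 0 < w i := fun i hi => (mem_union.1 hi).elim (hws i) (hwt i)
  have htendsto : Filter.Tendsto (fun τ' => τ' - τ) (nhds τ) (nhds 0) :=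
    (continuous_sub_right τ).tendsto' τ 0 (sub_self τ)
  filter_upwards [htendsto.eventually (eventually_forall_pos hw fun i => c * η i)] with τ' hτ'
  refine conesCross_contract_iff.2 ⟨_, fun i hi => hτ' i (mem_union_left t hi),
    fun i hi => hτ' i (mem_union_right s hi), c, ?_⟩
  rw [← sum_union_smul_reverseOutside hst] at hc ⊢
  simp only [add_smul, mul_smul, sum_add_distrib, ← smul_sum]
  rw [hη, ← hc]
  module

lemma isOpen_setOf_separated (e g : Dual ℝ E) :
    IsOpen {τ : ℝ | (∀ i ∈ s, 0 < (e (x + τ • y) • g - g (x + τ • y) • e) (u i)) ∧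
      ∀ i ∈ t, (e (x + τ • y) • g - g (x + τ • y) • e) (u i) < 0} := by
  have hcont : ∀ i, Continuous fun τ : ℝ => (e (x + τ • y) • g - g (x + τ • y) • e) (u i) := by
    intro i
    simp only [map_add, map_smul, LinearMap.sub_apply, LinearMap.smul_apply]
    fun_prop
  simp only [Set.ofPred_and, Set.ofPred_forall]
  exact (isOpen_biInter_finset fun i _ => isOpen_lt continuous_const (hcont i)).inter
    (isOpen_biInter_finset fun i _ => isOpen_lt (hcont i) continuous_const)

/-- If `u` stays generic in all contractions along a path, then crossing cones stay crossing: having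
crossing cones and having separated cones are both open conditions. -/
lemma ConesCross.of_isPreconnected [DecidableEq α] [FiniteDimensional ℝ E] {I : Set ℝ}
    (hI : IsPreconnected I) (hst : Disjoint s t) (hs : s.Nonempty) (hcard : finrank ℝ E ≤ #(s ∪ t))
    (hu : IsGeneric u (s ∪ t)) {e : Dual ℝ E} (he : ∀ τ ∈ I, 0 < e (x + τ • y))
    (hI_gen : ∀ τ ∈ I, IsGeneric (contract (x + τ • y) u) (s ∪ t)) {τ₀ τ : ℝ} (hτ₀ : τ₀ ∈ I)
    (hτ : τ ∈ I) (h : ConesCross (contract (x + τ₀ • y) u) s t) :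
    ConesCross (contract (x + τ • y) u) s t := by
  -- `e (x + τ • y) • g - g (x + τ • y) • e` makes a functional vanishing at `x + τ • y` out of `g`
  let N : Set ℝ := ⋃ g : Dual ℝ E,
    {τ | (∀ i ∈ s, 0 < (e (x + τ • y) • g - g (x + τ • y) • e) (u i)) ∧
      ∀ i ∈ t, (e (x + τ • y) • g - g (x + τ • y) • e) (u i) < 0}
  have hdisj : Disjoint {τ : ℝ | ConesCross (contract (x + τ • y) u) s t} N := by
    rw [Set.disjoint_left]
    rintro σ hσ hσN
    obtain ⟨g, hgs, hgt⟩ := Set.mem_iUnion.1 hσN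
    refine not_conesCross_contract hs ?_ hgs hgt hσ
    simp only [LinearMap.sub_apply, LinearMap.smul_apply, smul_eq_mul]
    ring
  refine hI.subset_left_of_subset_union (isOpen_setOf_conesCross_contract x y hst
    ((isGeneric_reverseOutside s hu).span_eq_top hcard))
    (isOpen_iUnion fun g => isOpen_setOf_separated x y e g) hdisj (fun σ hσ => ?_) ⟨τ₀, hτ₀, h⟩ hτ
  refine ((hI_gen σ hσ).conesCross_or_separated hst).imp_right fun ⟨g, hgs, hgt⟩ =>
    Set.mem_iUnion.2 ⟨g ∘ₗ (ℝ ∙ (x + σ • y)).mkQ, ?_⟩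
  have hg0 : (g ∘ₗ (ℝ ∙ (x + σ • y)).mkQ) (x + σ • y) = 0 := by
    rw [LinearMap.comp_apply, Submodule.mkQ_apply,
      (Submodule.Quotient.mk_eq_zero _).2 (Submodule.mem_span_singleton_self _), map_zero]
  simp only [Set.mem_ofPred_eq, hg0, zero_smul, sub_zero, LinearMap.smul_apply, smul_eq_mul]
  exact ⟨fun i hi => mul_pos (he σ hσ) (hgs i hi),
    fun i hi => mul_neg_of_pos_of_neg (he σ hσ) (hgt i hi)⟩

end Persistence

end Crossing

section Avoidance

variable {E V : Type*} [AddCommGroup E] [Module ℝ E] [AddCommGroup V] [Module ℝ V]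

/-- The configuration `A` avoids `B` if each hyperplane spanned by vectors of `A` has `B` strictly
on one side. -/
def Avoids (u : α → E) (A B : Finset α) : Prop :=
  ∀ D ⊆ A, #D + 1 = finrank ℝ E → ∃ g : Dual ℝ E, (∀ i ∈ D, g (u i) = 0) ∧ ∀ b ∈ B, 0 < g (u b)

lemma map_add_smul_sub_pos {g : Dual ℝ E} {x y : E} (hx : 0 < g x) (hy : 0 < g y) {τ : ℝ}
    (hτ : τ ∈ Set.Icc (0 : ℝ) 1) : 0 < g (x + τ • (y - x)) :=
  (convex_Ioi (0 : ℝ)).linear_preimage g |>.add_smul_sub_mem hx hy hτ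

lemma Avoids.isGeneric_contract_segment [FiniteDimensional ℝ E] {u : α → E} {A B : Finset α}
    (hAB : Avoids u A B) (hA : IsGeneric u A) (hcard : finrank ℝ E ≤ #A + 1) {b b' : α}
    (hb : b ∈ B) (hb' : b' ∈ B) {τ : ℝ} (hτ : τ ∈ Set.Icc (0 : ℝ) 1) :
    IsGeneric (contract (u b + τ • (u b' - u b)) u) A := by
  refine isGeneric_contract hA fun D hD hDE hz => ?_
  obtain ⟨D', hDD', hD'A, hD'⟩ :=
    exists_subsuperset_card_eq (n := finrank ℝ E - 1) hD (by omega) (by omega)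
  obtain ⟨g, hgD, hgB⟩ := hAB D' hD'A (by omega)
  have hspan : Submodule.span ℝ (u '' (D : Set α)) ≤ LinearMap.ker g := by
    rw [Submodule.span_le]
    rintro - ⟨i, hi, rfl⟩
    exact hgD i (hDD' hi)
  exact (map_add_smul_sub_pos (hgB b hb) (hgB b' hb') hτ).ne' (hspan hz)

lemma Avoids.conesCross_contract_segment [DecidableEq α] [FiniteDimensional ℝ E] {u : α → E}
    {A B s t : Finset α} {b b' : α} (hAB : Avoids u A B) (hA : IsGeneric u A) (hb : b ∈ B)
    (hb' : b' ∈ B) {e : Dual ℝ E} (he : ∀ i ∈ B, 0 < e (u i)) (hs : s ⊆ A) (ht : t ⊆ A)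
    (hst : Disjoint s t) (hs_ne : s.Nonempty) (hcard : finrank ℝ E ≤ #(s ∪ t))
    (h : ConesCross (contract (u b) u) s t) {τ : ℝ} (hτ : τ ∈ Set.Icc (0 : ℝ) 1) :
    ConesCross (contract (u b + τ • (u b' - u b)) u) s t := by
  have hst_A : s ∪ t ⊆ A := union_subset hs ht
  have hA_card := card_le_card hst_A
  refine ConesCross.of_isPreconnected (u b) (u b' - u b) isPreconnected_Icc hst hs_ne hcard
    (hA.mono hst_A) (fun σ hσ => map_add_smul_sub_pos (he b hb) (he b' hb') hσ)
    (fun σ hσ => (hAB.isGeneric_contract_segment hA (by omega) hb hb' hσ).mono hst_A)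
    (τ₀ := 0) (by simp) hτ ?_
  rwa [zero_smul, add_zero]

lemma disjoint_insert_insert [DecidableEq α] {A B s t : Finset α} {b b' : α} (hdisj : Disjoint A B)
    (hb : b ∈ B) (hb' : b' ∈ B) (hbb' : b ≠ b') (hs : s ⊆ A) (ht : t ⊆ A) (hst : Disjoint s t) :
    Disjoint (insert b s) (insert b' t) := by
  rw [disjoint_insert_left, disjoint_insert_right, mem_insert, not_or]
  exact ⟨⟨hbb', fun h => disjoint_right.1 hdisj hb (ht h)⟩,
    fun h => disjoint_right.1 hdisj hb' (hs h), hst⟩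

theorem Avoids.conesCross_insert [DecidableEq α] [FiniteDimensional ℝ E] {u : α → E}
    {A B P s t : Finset α} {b₀ b b' : α} (hAB : Avoids u A B) (hP : IsGeneric u P) (hA : A ⊆ P)
    (hB : B ⊆ P) (hdisj : Disjoint A B) (hb₀ : b₀ ∈ B) (hb : b ∈ B) (hb' : b' ∈ B) (hbb' : b ≠ b')
    {e : Dual ℝ E} (he : ∀ i ∈ B, 0 < e (u i)) (hs : s ⊆ A) (ht : t ⊆ A) (hst : Disjoint s t)
    (hs_ne : s.Nonempty) (hcard : finrank ℝ E ≤ #(s ∪ t))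
    (h : ConesCross (contract (u b₀) u) s t) : ConesCross u (insert b s) (insert b' t) := by
  have hins := disjoint_insert_insert hdisj hb hb' hbb' hs ht hst
  have hins_P : insert b s ∪ insert b' t ⊆ P := union_subset
    (insert_subset (hB hb) (hs.trans hA)) (insert_subset (hB hb') (ht.trans hA))
  have hb_cross : ConesCross (contract (u b) u) s t := by
    have := hAB.conesCross_contract_segment (hP.mono hA) hb₀ hb he hs ht hst hs_ne hcard h
      (Set.right_mem_Icc.2 zero_le_one)
    rwa [one_smul, add_sub_cancel] at this
  refine ((hP.mono hins_P).conesCross_or_separated hins).resolve_right ?_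
  -- the zero of a separating functional on the segment would be a viewpoint without crossing
  rintro ⟨g, hgs, hgt⟩
  have hgb := hgs b (mem_insert_self b s)
  have hgb' := hgt b' (mem_insert_self b' t)
  have hsub : 0 < g (u b) - g (u b') := by linarith
  set τ := g (u b) / (g (u b) - g (u b')) with hτ_def
  have hτ : τ ∈ Set.Icc (0 : ℝ) 1 := ⟨by positivity, by rw [div_le_one hsub]; linarith⟩
  have hgτ : g (u b + τ • (u b' - u b)) = 0 := by
    rw [map_add, map_smul, map_sub, smul_eq_mul, hτ_def]
    field_simp
    ring
  exact not_conesCross_contract hs_ne hgτ (fun i hi => hgs i (mem_insert_of_mem hi))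
    (fun i hi => hgt i (mem_insert_of_mem hi)) <|
      hAB.conesCross_contract_segment (hP.mono hA) hb hb' he hs ht hst hs_ne hcard hb_cross hτ

lemma IsGeneric.exists_homogenize [FiniteDimensional ℝ E] [FiniteDimensional ℝ V]
    (hEV : finrank ℝ E = finrank ℝ V + 1) {u : α → E} {P : Finset α} (h : IsGeneric u P)
    {f : Dual ℝ E} (hf0 : f ≠ 0) (hf : ∀ i ∈ P, 0 < f (u i)) :
    ∃ v : α → V, IsGeneric (homogenize v) P ∧
      ∀ s ⊆ P, ∀ t ⊆ P, ConesCross (homogenize v) s t → ConesCross u s t := by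
  obtain ⟨e, he⟩ := exists_linearEquiv_prod (V := V) hEV hf0
  have hv : ∀ i ∈ P, homogenize (fun i => (f (u i))⁻¹ • (e (u i)).1) i = e ((f (u i))⁻¹ • u i) := by
    intro i hi
    rw [map_smul]
    refine Prod.ext rfl ?_
    rw [Prod.smul_snd, he, smul_eq_mul, inv_mul_cancel₀ (hf i hi).ne', homogenize]
  refine ⟨fun i => (f (u i))⁻¹ • (e (u i)).1, fun S hS => ?_, fun s hs t ht => ?_⟩
  · rw [linearIndepOn_congr fun i hi => hv i (hS hi)]
    exact (isGeneric_map_iff e).2 (h.smul fun i hi => inv_ne_zero (hf i hi).ne') S hS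
  · rintro ⟨w, hws, hwt, hw⟩
    have hsum : ∀ s ⊆ P, ∑ i ∈ s, w i • homogenize (fun i => (f (u i))⁻¹ • (e (u i)).1) i =
        e (∑ i ∈ s, (w i * (f (u i))⁻¹) • u i) := fun s hs => by
      rw [map_sum]
      exact sum_congr rfl fun i hi => by
        rw [hv i (hs hi), mul_smul, map_smul, map_smul, map_smul]
    rw [hsum s hs, hsum t ht] at hw
    exact ⟨fun i => w i * (f (u i))⁻¹, fun i hi => mul_pos (hws i hi) (inv_pos.2 (hf i (hs hi))),
      fun i hi => mul_pos (hwt i hi) (inv_pos.2 (hf i (ht hi))), e.injective hw⟩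

/-- Central projection from a point `b` of a hyperplane with `A` strictly on one side. -/
lemma exists_homogenize_contract [DecidableEq α] [FiniteDimensional ℝ E] [FiniteDimensional ℝ V]
    (hEV : finrank ℝ E = finrank ℝ V + 2) {u : α → E} {A : Finset α} {b : α}
    (h : IsGeneric u (insert b A)) (hA : A.Nonempty) {f : Dual ℝ E} (hb : f (u b) = 0)
    (hfA : ∀ i ∈ A, 0 < f (u i)) :
    ∃ v : α → V, IsGeneric (homogenize v) A ∧
      ∀ s ⊆ A, ∀ t ⊆ A, ConesCross (homogenize v) s t → ConesCross (contract (u b) u) s t := by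
  have hbA : b ∉ A := fun hbA => (hfA b hbA).ne' hb
  have hub : u b ≠ 0 := by
    have := h {b} (by simp) (by simp [hEV])
    rw [coe_singleton] at this
    exact this.ne_zero (Set.mem_singleton b)
  have hfinrank := (ℝ ∙ u b).finrank_quotient_add_finrank
  rw [finrank_span_singleton hub] at hfinrank
  have hker : (ℝ ∙ u b) ≤ LinearMap.ker f := (Submodule.span_singleton_le_iff_mem _ _).2 hb
  obtain ⟨a, ha⟩ := hA
  refine (isGeneric_contract_of_insert hbA h).exists_homogenize (by omega)
    (f := (ℝ ∙ u b).liftQ f hker) (fun h0 => (hfA a ha).ne' ?_) hfA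
  rw [← Submodule.liftQ_apply (ℝ ∙ u b) f (h := hker), h0, LinearMap.zero_apply]

theorem Avoids.exists_isConeFamily_insert [FiniteDimensional ℝ E] {u : α → E} {A B P : Finset α}
    {b₀ : α} {k : ℕ} {F : Finset (Finset α)} (hAB : Avoids u A B) (hP : IsGeneric u P)
    (hA : A ⊆ P) (hB : B ⊆ P) (hdisj : Disjoint A B) (hb₀ : b₀ ∈ B) {e : Dual ℝ E}
    (he : ∀ i ∈ B, 0 < e (u i)) (hk : 0 < k) (hE : finrank ℝ E ≤ 2 * k)
    (hF : IsConeFamily (contract (u b₀) u) A k F) :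
    ∃ F', IsConeFamily u P (k + 1) F' ∧ #F' = min #F #B := by
  classical
  obtain ⟨F₀, hF₀, hF₀_card⟩ := exists_subset_card_eq (min_le_left #F #B)
  have : Nonempty α := ⟨b₀⟩
  obtain ⟨b, hb, hb_inj⟩ := F₀.finite_toSet.exists_injOn_of_encard_le (t := (B : Set α)) (by
    simp only [Set.encard_coe_eq_coe_finsetCard, hF₀_card]
    exact_mod_cast min_le_right _ _)
  have hbB : ∀ s ∈ F₀, b s ∈ B := fun s hs => hb hs
  have hsA : ∀ s ∈ F₀, s ⊆ A := fun s hs => hF.subset s (hF₀ hs)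
  have hsk : ∀ s ∈ F₀, #s = k := fun s hs => hF.card_eq s (hF₀ hs)
  rw [← hF₀_card]
  refine exists_isConeFamily_of_pairwise k.succ_pos (f := fun s => insert (b s) s)
    (fun s hs => insert_subset (hB (hbB s hs)) ((hsA s hs).trans hA)) (fun s hs => ?_)
    fun s hs t ht hne => ?_
  · rw [card_insert_of_notMem fun h => disjoint_right.1 hdisj (hbB s hs) (hsA s hs h), hsk s hs]
  · have hst := hF.disjoint (hF₀ hs) (hF₀ ht) hne
    have hbne : b s ≠ b t := hb_inj.ne hs ht hne
    have hcard : finrank ℝ E ≤ #(s ∪ t) := by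
      rwa [card_union_of_disjoint hst, hsk s hs, hsk t ht, ← two_mul]
    exact ⟨disjoint_insert_insert hdisj (hbB s hs) (hbB t ht) hbne (hsA s hs) (hsA t ht) hst,
      hAB.conesCross_insert hP hA hB hdisj hb₀ (hbB s hs) (hbB t ht) hbne he (hsA s hs) (hsA t ht)
        hst (card_pos.1 (by rw [hsk s hs]; exact hk)) hcard (hF.conesCross (hF₀ hs) (hF₀ ht) hne)⟩

theorem Avoids.exists_projection [FiniteDimensional ℝ V] {V' : Type*} [AddCommGroup V']
    [Module ℝ V'] [FiniteDimensional ℝ V'] (hV : finrank ℝ V = finrank ℝ V' + 1)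
    (hV' : 2 ≤ finrank ℝ V') {v : α → V} {A B P : Finset α} (hAB : Avoids (homogenize v) A B)
    (hP : IsGeneric (homogenize v) P) (hA : A ⊆ P) (hB : B ⊆ P) (hA_ne : A.Nonempty)
    (hB_ne : B.Nonempty) {f : Dual ℝ V} (hf : ∀ a ∈ A, ∀ b ∈ B, f (v b) < f (v a)) :
    ∃ v' : α → V', IsGeneric (homogenize v') A ∧
      ∀ F, IsConeFamily (homogenize v') A (finrank ℝ V') F →
        ∃ F', IsConeFamily (homogenize v) P (finrank ℝ V) F' ∧ #F' = min #F #B := by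
  classical
  obtain ⟨b, hb⟩ := hB_ne
  have hfinrank : finrank ℝ (V × ℝ) = finrank ℝ V' + 2 := by
    rw [finrank_prod, finrank_self, hV]
  obtain ⟨v', hv', hcross⟩ := exists_homogenize_contract (V := V') hfinrank
    (hP.mono (insert_subset (hB hb) hA)) hA_ne
    (f := f ∘ₗ LinearMap.fst ℝ V ℝ - f (v b) • LinearMap.snd ℝ V ℝ) (by simp [homogenize])
    fun a ha => by simpa [homogenize] using hf a ha b hb
  refine ⟨v', hv', fun F hF => ?_⟩
  rw [hV]
  exact hAB.exists_isConeFamily_insert hP hA hB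
    (disjoint_left.2 fun i hiA hiB => lt_irrefl _ (hf i hiA i hiB)) hb
    (e := LinearMap.snd ℝ V ℝ) (by simp [homogenize]) (by omega) (by omega)
    (hF.of_forall_conesCross hcross)

end Avoidance

section Arrangements

variable {ι κ V : Type*} [AddCommGroup V] [Module ℝ V]

/-- The hyperplane arrangement `{h i = 0}` is simple: hyperplanes with a common point have linearly
independent normals. -/
def IsSimpleArrangement (h : ι → V →ᵃ[ℝ] ℝ) : Prop :=
  ∀ T : Finset ι, (∃ x, ∀ i ∈ T, h i x = 0) →
    LinearIndepOn ℝ (fun i => (h i).linear) (T : Set ι)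

lemma affineMap_add_smul (h : V →ᵃ[ℝ] ℝ) (x w : V) (t : ℝ) :
    h (x + t • w) = h x + t * h.linear w := by
  rw [add_comm, ← vadd_eq_add, h.map_vadd, map_smul, vadd_eq_add, smul_eq_mul, add_comm]

lemma IsSimpleArrangement.comp {h : ι → V →ᵃ[ℝ] ℝ} (hh : IsSimpleArrangement h) (f : κ ↪ ι) :
    IsSimpleArrangement (h ∘ f) := by
  rintro T ⟨x, hx⟩
  have := hh (T.map f) ⟨x, fun i hi => by obtain ⟨k, hk, rfl⟩ := mem_map.1 hi; exact hx k hk⟩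
  rw [coe_map] at this
  exact this.comp_of_image f.injective.injOn

/-- The values of the functionals `g i`, `i ∈ T`, that are attained simultaneously. -/
def attainedValues (g : ι → Dual ℝ V) (T : Finset ι) : Submodule ℝ (ι → ℝ) :=
  (LinearMap.range (LinearMap.pi fun i : T => g i)).comap (LinearMap.funLeft ℝ ℝ Subtype.val)

lemma mem_attainedValues {g : ι → Dual ℝ V} {T : Finset ι} {c : ι → ℝ} :
    c ∈ attainedValues g T ↔ ∃ x, ∀ i ∈ T, g i x = c i := by
  simp [attainedValues, funext_iff, LinearMap.funLeft]

lemma linearIndepOn_of_attainedValues_eq_top {g : ι → Dual ℝ V} {T : Finset ι}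
    (h : attainedValues g T = ⊤) : LinearIndepOn ℝ g (T : Set ι) := by
  classical
  rw [linearIndepOn_finset_iff]
  intro w hw i hi
  obtain ⟨x, hx⟩ := mem_attainedValues.1 (h ▸ Submodule.mem_top : Pi.single i 1 ∈ _)
  calc w i = ∑ j ∈ T, w j * (Pi.single i 1 : ι → ℝ) j := by
        rw [sum_eq_single_of_mem i hi fun j _ hji => by rw [Pi.single_eq_of_ne hji, mul_zero],
          Pi.single_eq_same, mul_one]
    _ = (∑ j ∈ T, w j • g j) x := by
        rw [LinearMap.sum_apply]
        exact sum_congr rfl fun j hj => by rw [LinearMap.smul_apply, smul_eq_mul, hx j hj]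
    _ = 0 := by rw [hw, LinearMap.zero_apply]

lemma exists_small_add_smul_notMem {M : Type*} [AddCommGroup M] [Module ℝ M]
    (𝒲 : Finset (Submodule ℝ M)) (h𝒲 : ⊤ ∉ 𝒲) (c : M) :
    ∃ u : M, ∀ ε > 0, ∃ t ∈ Set.Ioo (0 : ℝ) ε, ∀ W ∈ 𝒲, c + t • u ∉ W := by
  obtain ⟨u, hu⟩ :=
    (Set.ne_univ_iff_exists_notMem _).1 (Subspace.biUnion_ne_univ_of_top_notMem h𝒲)
  have hfinite : (⋃ W ∈ 𝒲, {t : ℝ | c + t • u ∈ W}).Finite := by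
    refine Set.Finite.biUnion 𝒲.finite_toSet fun W hW => Set.Subsingleton.finite ?_
    intro t ht t' ht'
    by_contra hne
    have hsub : (c + t • u) - (c + t' • u) ∈ W := W.sub_mem ht ht'
    rw [add_sub_add_left_eq_sub, ← sub_smul] at hsub
    exact hu (Set.mem_biUnion hW ((W.smul_mem_iff (sub_ne_zero.2 hne)).1 hsub))
  refine ⟨u, fun ε hε => ?_⟩
  obtain ⟨t, ht, htW⟩ := (Set.Ioo_infinite hε).exists_notMem_finite hfinite
  exact ⟨t, ht, fun W hW htW' => htW (Set.mem_biUnion hW htW')⟩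

lemma exists_isSimpleArrangement_near [Finite ι] (h : ι → V →ᵃ[ℝ] ℝ) {ε : ℝ} (hε : 0 < ε) :
    ∃ h' : ι → V →ᵃ[ℝ] ℝ, (∀ i, (h' i).linear = (h i).linear) ∧ (∀ i x, |h' i x - h i x| < ε) ∧
      IsSimpleArrangement h' := by
  classical
  have := Fintype.ofFinite ι
  obtain ⟨u, hu⟩ := exists_small_add_smul_notMem
    ((univ.image (attainedValues fun i => (h i).linear)).erase ⊤) (notMem_erase _ _)
    (fun i => -h i 0)
  obtain ⟨t, ⟨ht0, ht⟩, htW⟩ := hu (ε / (1 + ‖u‖)) (by positivity)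
  refine ⟨fun i => h i - AffineMap.const ℝ V (t * u i), fun i => by simp, fun i x => ?_,
    fun T hT => ?_⟩
  · rw [lt_div_iff₀ (by positivity)] at ht
    have hui : |u i| ≤ ‖u‖ := norm_le_pi_norm u i
    calc |(h i - AffineMap.const ℝ V (t * u i)) x - h i x| = t * |u i| := by
          rw [AffineMap.coe_sub, Pi.sub_apply, AffineMap.const_apply, sub_sub_cancel_left, abs_neg,
            abs_mul, abs_of_pos ht0]
      _ < ε := by nlinarith
  · obtain ⟨x, hx⟩ := hT
    have hmem : (fun i => -h i 0) + t • u ∈ attainedValues (fun i => (h i).linear) T := by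
      refine mem_attainedValues.2 ⟨x, fun i hi => ?_⟩
      have hxi : h i x - t * u i = 0 := hx i hi
      have hx0 : h i x = h i 0 + (h i).linear x := by simpa using affineMap_add_smul (h i) 0 x 1
      simp only [Pi.add_apply, Pi.smul_apply, smul_eq_mul]
      linarith
    have htop : attainedValues (fun i => (h i).linear) T = ⊤ := by
      by_contra hne
      exact htW _ (mem_erase.2 ⟨hne, mem_image_of_mem _ (mem_univ T)⟩) hmem
    simpa using linearIndepOn_of_attainedValues_eq_top htop

/-- The position of `x` with respect to the hyperplanes of the arrangement. -/
noncomputable def signVector (h : ι → V →ᵃ[ℝ] ℝ) (x : V) (i : ι) : SignType :=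
  SignType.sign (h i x)

/-- The closed face of the arrangement with sign vector `σ`: points that are, for each `i`, on the
side `σ i` of the hyperplane `h i = 0` or on that hyperplane. -/
def closedFace (h : ι → V →ᵃ[ℝ] ℝ) (σ : ι → SignType) : Set V :=
  {y | ∀ i, h i y ≠ 0 → σ i = signVector h y i}

/-- The hyperplanes through `x`. -/
noncomputable def zeros [Fintype ι] (h : ι → V →ᵃ[ℝ] ℝ) (x : V) : Finset ι :=
  {i | h i x = 0}

/-- The face of the arrangement through `x` contains no ray that starts at `x`. -/
def HasBoundedFace (h : ι → V →ᵃ[ℝ] ℝ) (x : V) : Prop :=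
  ∀ w ≠ 0, (∀ i, h i x = 0 → (h i).linear w = 0) → ∃ i, h i x * (h i).linear w < 0

variable {h : ι → V →ᵃ[ℝ] ℝ} {x y z : V} {σ : ι → SignType}

lemma mem_closedFace_signVector (h : ι → V →ᵃ[ℝ] ℝ) (x : V) : x ∈ closedFace h (signVector h x) :=
  fun _ _ => rfl

lemma apply_eq_zero_of_mem_closedFace {i : ι} (hy : y ∈ closedFace h (signVector h x))
    (hi : h i x = 0) : h i y = 0 := by
  by_contra hne
  have hsign : SignType.sign (h i x) = SignType.sign (h i y) := hy i hne
  rw [hi, sign_zero, eq_comm, sign_eq_zero_iff] at hsign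
  exact hne hsign

lemma closedFace_signVector_subset (hy : y ∈ closedFace h σ) :
    closedFace h (signVector h y) ⊆ closedFace h σ :=
  fun _ hz i hi => (hy i fun h0 => hi (apply_eq_zero_of_mem_closedFace hz h0)).trans (hz i hi)

lemma mul_nonneg_of_mem_closedFace (hy : y ∈ closedFace h σ) (hz : z ∈ closedFace h σ) (i : ι) :
    0 ≤ h i y * h i z := by
  by_cases hy0 : h i y = 0
  · rw [hy0, zero_mul]
  by_cases hz0 : h i z = 0
  · rw [hz0, mul_zero]
  have hsign : SignType.sign (h i y) = SignType.sign (h i z) := (hy i hy0).symm.trans (hz i hz0)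
  rcases lt_or_gt_of_ne hz0 with hz | hz
  · rw [sign_neg hz, sign_eq_neg_one_iff] at hsign
    exact mul_nonneg_of_nonpos_of_nonpos hsign.le hz.le
  · rw [sign_pos hz, sign_eq_one_iff] at hsign
    exact mul_nonneg hsign.le hz.le

lemma HasBoundedFace.of_mem_closedFace (hx : HasBoundedFace h x)
    (hy : y ∈ closedFace h (signVector h x)) : HasBoundedFace h y := by
  intro w hw hwy
  obtain ⟨i, hi⟩ := hx w hw fun i hi => hwy i (apply_eq_zero_of_mem_closedFace hy hi)
  have hne : h i y ≠ 0 := fun h0 => hi.ne (by rw [hwy i h0, mul_zero])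
  have hsign : SignType.sign (h i x) = SignType.sign (h i y) := hy i hne
  refine ⟨i, ?_⟩
  rwa [← sign_eq_neg_one_iff, sign_mul, ← hsign, ← sign_mul, sign_eq_neg_one_iff]

lemma add_smul_mem_closedFace {w : V} {t : ℝ} (ht : 0 ≤ t)
    (hzero : ∀ i, h i x = 0 → (h i).linear w = 0)
    (hle : ∀ i, h i x * (h i).linear w < 0 → t ≤ -h i x / (h i).linear w) :
    x + t • w ∈ closedFace h (signVector h x) := by
  intro i hi
  rw [affineMap_add_smul] at hi
  change SignType.sign (h i x) = SignType.sign (h i (x + t • w))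
  rw [affineMap_add_smul]
  rcases lt_trichotomy (h i x) 0 with hix | hix | hix
  · rw [sign_neg hix, sign_neg (lt_of_le_of_ne ?_ hi)]
    by_cases hiw : 0 < (h i).linear w
    · have := (le_div_iff₀ hiw).1 (hle i (mul_neg_of_neg_of_pos hix hiw))
      linarith
    · linarith [mul_nonpos_of_nonneg_of_nonpos ht (not_lt.1 hiw)]
  · rw [hix, hzero i hix, mul_zero, add_zero]
  · rw [sign_pos hix, sign_pos (lt_of_le_of_ne ?_ hi.symm)]
    by_cases hiw : (h i).linear w < 0
    · have := (le_div_iff_of_neg hiw).1 (hle i (mul_neg_of_pos_of_neg hix hiw))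
      linarith
    · linarith [mul_nonneg ht (not_lt.1 hiw)]

variable [Fintype ι]

lemma mem_zeros {i : ι} : i ∈ zeros h x ↔ h i x = 0 := by
  rw [zeros, mem_filter_univ]

lemma zeros_subset_of_mem_closedFace (hy : y ∈ closedFace h (signVector h x)) :
    zeros h x ⊆ zeros h y :=
  fun _ hi => mem_zeros.2 (apply_eq_zero_of_mem_closedFace hy (mem_zeros.1 hi))

open Classical in
lemma card_filter_mem_closedFace (h : ι → V →ᵃ[ℝ] ℝ) (y : V) :
    #{σ : ι → SignType | y ∈ closedFace h σ} = 3 ^ #(zeros h y) := by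
  have heq : ({σ : ι → SignType | y ∈ closedFace h σ} : Finset _) =
      Fintype.piFinset fun i => if h i y = 0 then univ else {signVector h y i} := by
    ext σ
    rw [mem_filter_univ, Fintype.mem_piFinset]
    refine forall_congr' fun i => ?_
    by_cases hi : h i y = 0 <;> simp [hi]
  have hcard : Fintype.card SignType = 3 := rfl
  rw [heq, Fintype.card_piFinset, zeros, ← prod_const, prod_filter]
  refine prod_congr rfl fun i _ => ?_
  split_ifs
  · rw [card_univ, hcard]
  · exact card_singleton _

lemma HasBoundedFace.exists_exit (hx : HasBoundedFace h x) {w : V} (hw : w ≠ 0)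
    (hzero : ∀ i, h i x = 0 → (h i).linear w = 0) :
    ∃ t : ℝ, 0 < t ∧ x + t • w ∈ closedFace h (signVector h x) ∧
      #(zeros h x) < #(zeros h (x + t • w)) := by
  classical
  have hne : ({i | h i x * (h i).linear w < 0} : Finset ι).Nonempty := by
    obtain ⟨i, hi⟩ := hx w hw hzero
    exact ⟨i, (mem_filter_univ i).2 hi⟩
  obtain ⟨j, hj, hmin⟩ := exists_min_image _ (fun i => -h i x / (h i).linear w) hne
  rw [mem_filter_univ] at hj
  have hjw : (h j).linear w ≠ 0 := right_ne_zero_of_mul hj.ne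
  set t := -h j x / (h j).linear w with ht
  have ht0 : 0 < t := by
    rw [ht, ← mul_div_mul_right _ _ hjw, neg_mul]
    exact div_pos (neg_pos.2 hj) (mul_self_pos.2 hjw)
  have hcell := add_smul_mem_closedFace ht0.le hzero fun i hi =>
    hmin i ((mem_filter_univ i).2 hi)
  refine ⟨t, ht0, hcell, card_lt_card ⟨zeros_subset_of_mem_closedFace hcell, fun hsub => ?_⟩⟩
  have hjt : j ∈ zeros h (x + t • w) := by
    rw [mem_zeros, affineMap_add_smul, ht, div_mul_cancel₀ _ hjw, add_neg_cancel]
  exact left_ne_zero_of_mul hj.ne (mem_zeros.1 (hsub hjt))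

/-- The vertices of a simple arrangement: points on as many hyperplanes as the dimension. -/
def IsVertex (h : ι → V →ᵃ[ℝ] ℝ) (x : V) : Prop := #(zeros h x) = finrank ℝ V

open Classical in
/-- A vertex of the closed face with sign vector `σ`; the junk value `0` if there is none. -/
noncomputable def faceVertex (h : ι → V →ᵃ[ℝ] ℝ) (σ : ι → SignType) : V :=
  if hσ : ∃ y ∈ closedFace h σ, IsVertex h y then hσ.choose else 0

open Classical in
/-- Points of the face `σ` are pushed away from `faceVertex h σ` into a smaller face, and so on
until a vertex `y` is reached; `flagVertices h y σ` collects the vertices `faceVertex h τ` that can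
be used on the way. -/
noncomputable def flagVertices (h : ι → V →ᵃ[ℝ] ℝ) (y : V) (σ : ι → SignType) : Finset V :=
  image (faceVertex h) {τ | y ∈ closedFace h τ ∧ faceVertex h τ ∈ closedFace h σ ∧
    IsVertex h (faceVertex h τ)}

lemma mem_flagVertices {u : V} : u ∈ flagVertices h y σ ↔ ∃ τ, (y ∈ closedFace h τ ∧
    faceVertex h τ ∈ closedFace h σ ∧ IsVertex h (faceVertex h τ)) ∧ faceVertex h τ = u := by
  simp only [flagVertices, mem_image, mem_filter_univ]

lemma flagVertices_subset_flagVertices (hx : x ∈ closedFace h σ) :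
    flagVertices h y (signVector h x) ⊆ flagVertices h y σ := by
  intro u
  simp only [mem_flagVertices]
  rintro ⟨τ, ⟨hyτ, hτ, hv⟩, rfl⟩
  exact ⟨τ, ⟨hyτ, closedFace_signVector_subset hx hτ, hv⟩, rfl⟩

lemma card_flagVertices_le (hy : IsVertex h y) : #(flagVertices h y σ) ≤ 3 ^ finrank ℝ V := by
  classical
  refine card_image_le.trans ?_
  rw [← hy, ← card_filter_mem_closedFace h y]
  exact card_le_card fun τ hτ => (mem_filter_univ τ).2 ((mem_filter_univ τ).1 hτ).1

variable [FiniteDimensional ℝ V]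

lemma IsSimpleArrangement.card_zeros_le (hh : IsSimpleArrangement h) (x : V) :
    #(zeros h x) ≤ finrank ℝ V := by
  have hli := hh (zeros h x) ⟨x, fun i hi => mem_zeros.1 hi⟩
  have := LinearIndependent.fintype_card_le_finrank hli
  rwa [Subspace.dual_finrank_eq, ← Nat.card_eq_fintype_card, Nat.card_coe_set_eq,
    Set.ncard_coe_finset] at this

lemma IsSimpleArrangement.eq_of_card_zeros (hh : IsSimpleArrangement h)
    (hx : #(zeros h x) = finrank ℝ V) (hxy : zeros h x ⊆ zeros h y) : y = x := by
  have hli := hh (zeros h x) ⟨x, fun i hi => mem_zeros.1 hi⟩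
  have hspan : Submodule.span ℝ ((fun i => (h i).linear) '' (zeros h x : Set ι)) = ⊤ := by
    rw [Set.image_eq_range]
    refine LinearIndependent.span_eq_top_of_card_eq_finrank' hli ?_
    rw [Subspace.dual_finrank_eq, ← hx]
    exact Fintype.card_coe _
  have hle : (⊤ : Submodule ℝ (Dual ℝ V)) ≤ LinearMap.ker (Dual.eval ℝ V (y - x)) := by
    rw [← hspan, Submodule.span_le]
    rintro _ ⟨i, hi, rfl⟩
    have hyi : h i (x + (1 : ℝ) • (y - x)) = 0 := by
      rw [one_smul, add_sub_cancel]
      exact mem_zeros.1 (hxy hi)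
    rw [affineMap_add_smul, mem_zeros.1 hi, zero_add, one_mul] at hyi
    exact hyi
  exact sub_eq_zero.1 ((forall_dual_apply_eq_zero_iff ℝ _).1 fun f => hle Submodule.mem_top)

lemma IsSimpleArrangement.exists_finset_vertices (hh : IsSimpleArrangement h) :
    ∃ 𝒱 : Finset V, (∀ x, x ∈ 𝒱 ↔ IsVertex h x) ∧ #𝒱 ≤ Fintype.card ι ^ finrank ℝ V := by
  have hmaps : Set.MapsTo (zeros h) {x | IsVertex h x}
      ↑(powersetCard (finrank ℝ V) (univ : Finset ι)) :=
    fun x hx => mem_coe.2 (mem_powersetCard.2 ⟨subset_univ _, hx⟩)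
  have hinj : Set.InjOn (zeros h) {x | IsVertex h x} := fun x _ y hy hxy =>
    hh.eq_of_card_zeros hy hxy.ge
  have hfin : {x | IsVertex h x}.Finite :=
    Set.Finite.of_injOn hmaps hinj (finite_toSet _)
  refine ⟨hfin.toFinset, fun x => hfin.mem_toFinset, ?_⟩
  rw [← hfin.coe_toFinset] at hmaps hinj
  refine (card_le_card_of_injOn _ hmaps hinj).trans ?_
  rw [card_powersetCard, card_univ]
  exact Nat.choose_le_pow _ _

lemma IsSimpleArrangement.exists_vertex (hh : IsSimpleArrangement h) (hx : HasBoundedFace h x) :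
    ∃ y ∈ closedFace h (signVector h x), IsVertex h y := by
  induction hn : finrank ℝ V - #(zeros h x) using Nat.strong_induction_on generalizing x with
  | _ n ih =>
    by_cases hlt : #(zeros h x) < finrank ℝ V
    · have hker : LinearMap.ker (LinearMap.pi fun i : zeros h x => (h i).linear) ≠ ⊥ :=
        LinearMap.ker_ne_bot_of_finrank_lt (by simpa using hlt)
      obtain ⟨w, hw, hw0⟩ := (Submodule.ne_bot_iff _).1 hker
      obtain ⟨t, -, hcell, hcard⟩ :=
        hx.exists_exit hw0 fun i hi =>
          congrFun (LinearMap.mem_ker.1 hw) ⟨i, mem_zeros.2 hi⟩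
      obtain ⟨y, hy, hyv⟩ := ih _ (by omega) (hx.of_mem_closedFace hcell) rfl
      exact ⟨y, closedFace_signVector_subset hcell hy, hyv⟩
    · exact ⟨x, mem_closedFace_signVector h x, (hh.card_zeros_le x).antisymm (not_lt.1 hlt)⟩

lemma IsSimpleArrangement.faceVertex_spec (hh : IsSimpleArrangement h) (hx : HasBoundedFace h x) :
    faceVertex h (signVector h x) ∈ closedFace h (signVector h x) ∧
      IsVertex h (faceVertex h (signVector h x)) := by
  have hex := hh.exists_vertex hx
  rw [faceVertex, dif_pos hex]
  exact hex.choose_spec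

lemma IsSimpleArrangement.exists_mem_convexHull_flagVertices (hh : IsSimpleArrangement h)
    (hx : HasBoundedFace h x) : ∃ y ∈ closedFace h (signVector h x), IsVertex h y ∧
      x ∈ convexHull ℝ (flagVertices h y (signVector h x) : Set V) := by
  induction hn : finrank ℝ V - #(zeros h x) using Nat.strong_induction_on generalizing x with
  | _ n ih =>
    obtain ⟨hu, huv⟩ := hh.faceVertex_spec hx
    set u := faceVertex h (signVector h x)
    by_cases hlt : #(zeros h x) < finrank ℝ V
    · have hxu : x - u ≠ 0 := fun h0 => hlt.ne (sub_eq_zero.1 h0 ▸ huv)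
      obtain ⟨t, ht, hcell, hcard⟩ := hx.exists_exit hxu fun i hi => by
        have hui := apply_eq_zero_of_mem_closedFace hu hi
        have hxi := affineMap_add_smul (h i) u (x - u) 1
        rw [one_smul, add_sub_cancel, hui, hi] at hxi
        linarith
      obtain ⟨y, hy, hyv, hmem⟩ := ih _ (by omega) (hx.of_mem_closedFace hcell) rfl
      have hyx := closedFace_signVector_subset hcell hy
      refine ⟨y, hyx, hyv, (convex_convexHull ℝ _).segment_subset
        (subset_convexHull ℝ _ (mem_coe.2 (mem_flagVertices.2 ⟨_, ⟨hyx, hu, huv⟩, rfl⟩)))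
        (convexHull_mono (coe_subset.2 (flagVertices_subset_flagVertices hcell)) hmem) ?_⟩
      refine ⟨t / (1 + t), 1 / (1 + t), by positivity, by positivity, by field, ?_⟩
      match_scalars <;> field
    · have hxv : IsVertex h x := (hh.card_zeros_le x).antisymm (not_lt.1 hlt)
      have hux : u = x := hh.eq_of_card_zeros hxv (zeros_subset_of_mem_closedFace hu)
      refine ⟨x, mem_closedFace_signVector h x, hxv, subset_convexHull ℝ _ (mem_coe.2 ?_)⟩
      exact mem_flagVertices.2 ⟨_, ⟨mem_closedFace_signVector h x, hu, huv⟩, hux⟩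

lemma IsSimpleArrangement.exists_convexHull_cover (hh : IsSimpleArrangement h) :
    ∃ 𝒯 : Finset (Finset V), #𝒯 ≤ Fintype.card ι ^ finrank ℝ V * 3 ^ finrank ℝ V ∧
      (∀ x, HasBoundedFace h x → ∃ τ ∈ 𝒯, x ∈ convexHull ℝ (τ : Set V)) ∧
      ∀ τ ∈ 𝒯, #τ ≤ 3 ^ finrank ℝ V ∧ (∀ u ∈ τ, IsVertex h u) ∧
        ∀ u ∈ τ, ∀ u' ∈ τ, ∀ i, 0 ≤ h i u * h i u' := by
  classical
  obtain ⟨𝒱, h𝒱, h𝒱_card⟩ := hh.exists_finset_vertices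
  refine ⟨𝒱.biUnion fun y => image (flagVertices h y) {σ | y ∈ closedFace h σ}, ?_, fun x hx => ?_,
    fun τ hτ => ?_⟩
  · refine (card_biUnion_le_card_mul _ _ (3 ^ finrank ℝ V) fun y hy => ?_).trans
      (Nat.mul_le_mul_right _ h𝒱_card)
    rw [← (h𝒱 y).1 hy, ← card_filter_mem_closedFace h y]
    exact card_image_le
  · obtain ⟨y, hyx, hy, hmem⟩ := hh.exists_mem_convexHull_flagVertices hx
    exact ⟨_, mem_biUnion.2 ⟨y, (h𝒱 y).2 hy, mem_image_of_mem _ ((mem_filter_univ _).2 hyx)⟩, hmem⟩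
  · obtain ⟨y, hy, hτy⟩ := mem_biUnion.1 hτ
    obtain ⟨σ, -, rfl⟩ := mem_image.1 hτy
    refine ⟨card_flagVertices_le ((h𝒱 y).1 hy), fun u hu => ?_, fun u hu u' hu' i => ?_⟩
    · obtain ⟨ρ, ⟨-, -, hρ⟩, rfl⟩ := mem_flagVertices.1 hu
      exact hρ
    · obtain ⟨ρ, ⟨-, hρ, -⟩, rfl⟩ := mem_flagVertices.1 hu
      obtain ⟨ρ', ⟨-, hρ', -⟩, rfl⟩ := mem_flagVertices.1 hu'
      exact mul_nonneg_of_mem_closedFace hρ hρ' i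

end Arrangements

section HittingSets

variable {κ : Type*} [Fintype κ] [Nonempty κ] {𝓕 : Finset (Finset κ)} {δ : ℝ}

lemma exists_mul_card_le_card_filter_mem [DecidableEq κ] (h𝓕 : ∀ X ∈ 𝓕, δ * Fintype.card κ ≤ #X) :
    ∃ i, δ * #𝓕 ≤ #{X ∈ 𝓕 | i ∈ X} := by
  by_contra! hlt
  have hcount := sum_card_bipartiteAbove_eq_sum_card_bipartiteBelow (s := (univ : Finset κ))
    (t := 𝓕) (fun i X => i ∈ X)
  simp only [bipartiteAbove, bipartiteBelow, filter_mem_eq_inter, univ_inter] at hcount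
  have hsum : (∑ X ∈ 𝓕, #X : ℝ) < Fintype.card κ * (δ * #𝓕) := by
    have := sum_lt_sum_of_nonempty (univ_nonempty (α := κ)) fun i _ => hlt i
    rwa [sum_const, nsmul_eq_mul, card_univ, ← Nat.cast_sum, hcount, Nat.cast_sum] at this
  have := card_nsmul_le_sum 𝓕 (fun X => (#X : ℝ)) _ h𝓕
  rw [nsmul_eq_mul] at this
  linarith

lemma exists_card_filter_disjoint_le [DecidableEq κ] (h𝓕 : ∀ X ∈ 𝓕, δ * Fintype.card κ ≤ #X)
    (hδ : δ ≤ 1) (s : ℕ) :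
    ∃ S : Finset κ, #S ≤ s ∧ (#{X ∈ 𝓕 | Disjoint S X} : ℝ) ≤ (1 - δ) ^ s * #𝓕 := by
  induction s with
  | zero => exact ⟨∅, by simp, by simp⟩
  | succ s ih =>
    obtain ⟨S, hS, hle⟩ := ih
    obtain ⟨i, hi⟩ := exists_mul_card_le_card_filter_mem (𝓕 := {X ∈ 𝓕 | Disjoint S X})
      fun X hX => h𝓕 X (mem_filter.1 hX).1
    have hsplit : (#{X ∈ {X ∈ 𝓕 | Disjoint S X} | i ∈ X} : ℝ) +
        #{X ∈ {X ∈ 𝓕 | Disjoint S X} | i ∉ X} = #{X ∈ 𝓕 | Disjoint S X} :=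
      mod_cast card_filter_add_card_filter_not _
    have heq : {X ∈ 𝓕 | Disjoint (insert i S) X} = {X ∈ {X ∈ 𝓕 | Disjoint S X} | i ∉ X} := by
      simp only [disjoint_insert_left, filter_filter, and_comm]
    refine ⟨insert i S, (card_insert_le _ _).trans (by omega), ?_⟩
    calc (#{X ∈ 𝓕 | Disjoint (insert i S) X} : ℝ) ≤ (1 - δ) * #{X ∈ 𝓕 | Disjoint S X} := by
          rw [heq]
          linarith
      _ ≤ (1 - δ) * ((1 - δ) ^ s * #𝓕) := mul_le_mul_of_nonneg_left hle (by linarith)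
      _ = (1 - δ) ^ (s + 1) * #𝓕 := by ring

lemma exists_hitting_set (h𝓕 : ∀ X ∈ 𝓕, δ * Fintype.card κ ≤ #X) (hδ : δ ≤ 1) {s : ℕ}
    (hs : (1 - δ) ^ s * #𝓕 < 1) : ∃ S : Finset κ, #S ≤ s ∧ ∀ X ∈ 𝓕, ¬Disjoint S X := by
  classical
  obtain ⟨S, hS, hle⟩ := exists_card_filter_disjoint_le h𝓕 hδ s
  have hzero : #{X ∈ 𝓕 | Disjoint S X} = 0 := Nat.lt_one_iff.1 (mod_cast hle.trans_lt hs)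
  exact ⟨S, hS, fun X hX hdisj =>
    notMem_empty X (card_eq_zero.1 hzero ▸ mem_filter.2 ⟨hX, hdisj⟩)⟩

end HittingSets

section Cuttings

lemma card_biUnion_product_le_mul {κ : Type*} [DecidableEq κ] {τ : Finset α}
    {f : α × α → Finset κ} {c : ℝ} {n : ℕ} (hc : 0 ≤ c) (hτ : #τ ≤ n)
    (hf : ∀ x ∈ τ, ∀ y ∈ τ, (#(f (x, y)) : ℝ) ≤ c) :
    (#((τ ×ˢ τ).biUnion f) : ℝ) ≤ n ^ 2 * c := by
  have hf' : ∀ xy ∈ τ ×ˢ τ, (#(f xy) : ℝ) ≤ c := fun xy hxy =>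
    hf _ (mem_product.1 hxy).1 _ (mem_product.1 hxy).2
  calc (#((τ ×ˢ τ).biUnion f) : ℝ) ≤ ∑ xy ∈ τ ×ˢ τ, (#(f xy) : ℝ) := mod_cast card_biUnion_le
    _ ≤ #(τ ×ˢ τ) * c := by
        rw [← nsmul_eq_mul]
        exact sum_le_card_nsmul _ _ _ hf'
    _ ≤ n ^ 2 * c := by
        rw [card_product, Nat.cast_mul, ← sq]
        gcongr

variable {ι κ β V : Type*} [AddCommGroup V] [Module ℝ V]

/-- The hyperplanes `h k = 0` that strictly separate `x` from `y`. -/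
noncomputable def separators [Fintype κ] (h : κ → V →ᵃ[ℝ] ℝ) (x y : V) : Finset κ :=
  {k | h k x * h k y < 0}

lemma exists_card_separators_lt [Fintype κ] [Nonempty κ] (h : κ → V →ᵃ[ℝ] ℝ) (𝒱 : Finset V)
    {δ : ℝ} (hδ : δ ≤ 1) {s : ℕ} (hs : (1 - δ) ^ s * (#𝒱 : ℝ) ^ 2 < 1) :
    ∃ S : Finset κ, #S ≤ s ∧ ∀ x ∈ 𝒱, ∀ y ∈ 𝒱, (∀ k ∈ S, 0 ≤ h k x * h k y) →
      #(separators h x y) < δ * Fintype.card κ := by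
  classical
  set 𝓕 := {X ∈ (𝒱 ×ˢ 𝒱).image fun xy => separators h xy.1 xy.2 | δ * Fintype.card κ ≤ #X}
  have hcard : (#𝓕 : ℝ) ≤ (#𝒱 : ℝ) ^ 2 := by
    have : #𝓕 ≤ #𝒱 ^ 2 := by
      rw [sq, ← card_product]
      exact (card_filter_le _ _).trans card_image_le
    exact_mod_cast this
  obtain ⟨S, hS, hhit⟩ := exists_hitting_set (𝓕 := 𝓕) (fun X hX => (mem_filter.1 hX).2) hδ
    ((mul_le_mul_of_nonneg_left hcard (pow_nonneg (sub_nonneg.2 hδ) s)).trans_lt hs)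
  refine ⟨S, hS, fun x hx y hy hxy => ?_⟩
  by_contra! hle
  obtain ⟨k, hkS, hk⟩ := not_disjoint_iff.1 (hhit (separators h x y) (mem_filter.2
    ⟨mem_image.2 ⟨(x, y), mem_product.2 ⟨hx, hy⟩, rfl⟩, hle⟩))
  exact (hxy k hkS).not_gt ((mem_filter_univ k).1 hk)

variable [FiniteDimensional ℝ V]

lemma IsVertex.of_comp [Fintype ι] [Fintype κ] {h : ι → V →ᵃ[ℝ] ℝ} (hh : IsSimpleArrangement h)
    {f : κ ↪ ι} {x : V} (hx : IsVertex (h ∘ f) x) : IsVertex h x := by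
  refine (hh.card_zeros_le x).antisymm ?_
  rw [← show #(zeros (h ∘ f) x) = finrank ℝ V from hx, ← card_map f]
  refine card_le_card fun i hi => ?_
  obtain ⟨k, hk, rfl⟩ := mem_map.1 hi
  exact mem_zeros.2 (mem_zeros (h := h ∘ f).1 hk)

/-- A cutting, obtained from a random sample `S` of the hyperplanes `Sum.inl`: pieces of the
arrangement formed by `S` and the sides `Sum.inr` of a box. -/
theorem IsSimpleArrangement.exists_cutting [Fintype κ] [Nonempty κ] [Fintype β]
    {h : κ ⊕ β → V →ᵃ[ℝ] ℝ} (hh : IsSimpleArrangement h)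
    (hbox : ∀ w ≠ 0, ∃ j : β, (h (Sum.inr j)).linear w < 0) {δ : ℝ} (hδ0 : 0 ≤ δ) (hδ1 : δ ≤ 1)
    {s : ℕ} (hs : (1 - δ) ^ s *
      (((Fintype.card κ + Fintype.card β : ℕ) : ℝ) ^ finrank ℝ V) ^ 2 < 1) :
    ∃ 𝒯 : Finset (Finset V),
      #𝒯 ≤ (s + Fintype.card β) ^ finrank ℝ V * 3 ^ finrank ℝ V ∧
      (∀ x, (∀ j : β, 0 < h (Sum.inr j) x) → ∃ τ ∈ 𝒯, x ∈ convexHull ℝ (τ : Set V)) ∧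
      ∀ τ ∈ 𝒯, ∃ X : Finset κ, #X ≤ 9 ^ finrank ℝ V * (δ * Fintype.card κ) ∧
        ∀ k ∉ X, (∀ u ∈ τ, 0 ≤ h (Sum.inl k) u) ∨ ∀ u ∈ τ, h (Sum.inl k) u ≤ 0 := by
  classical
  obtain ⟨𝒱, h𝒱, h𝒱_card⟩ := hh.exists_finset_vertices
  rw [Fintype.card_sum] at h𝒱_card
  have hs' : (1 - δ) ^ s * (#𝒱 : ℝ) ^ 2 < 1 := by
    refine lt_of_le_of_lt (mul_le_mul_of_nonneg_left ?_ (pow_nonneg (sub_nonneg.2 hδ1) s)) hs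
    gcongr
    exact_mod_cast h𝒱_card
  obtain ⟨S, hS, hsep⟩ := exists_card_separators_lt (h ∘ Sum.inl) 𝒱 hδ1 hs'
  let f : S ⊕ β ↪ κ ⊕ β := (Function.Embedding.subtype _).sumMap (Function.Embedding.refl β)
  obtain ⟨𝒯, h𝒯_card, hcover, h𝒯⟩ := (hh.comp f).exists_convexHull_cover
  refine ⟨𝒯, h𝒯_card.trans ?_, fun x hx => hcover x fun w hw _ => ?_, fun τ hτ => ?_⟩
  · rw [Fintype.card_sum, Fintype.card_coe]
    gcongr
  · obtain ⟨j, hj⟩ := hbox w hw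
    exact ⟨Sum.inr j, mul_neg_of_pos_of_neg (hx j) hj⟩
  obtain ⟨hτ_card, hτ_vertex, hτ_side⟩ := h𝒯 τ hτ
  have hτ𝒱 : ∀ u ∈ τ, u ∈ 𝒱 := fun u hu => (h𝒱 u).2 ((hτ_vertex u hu).of_comp hh)
  refine ⟨(τ ×ˢ τ).biUnion fun uu => separators (h ∘ Sum.inl) uu.1 uu.2, ?_, fun k hk => ?_⟩
  · have hsep' : ∀ u ∈ τ, ∀ u' ∈ τ,
        (#(separators (h ∘ Sum.inl) u u') : ℝ) ≤ δ * Fintype.card κ := fun u hu u' hu' =>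
      (hsep u (hτ𝒱 u hu) u' (hτ𝒱 u' hu') fun k hk =>
        hτ_side u hu u' hu' (Sum.inl ⟨k, hk⟩)).le
    refine (card_biUnion_product_le_mul (by positivity) hτ_card hsep').trans_eq ?_
    rw [Nat.cast_pow, ← pow_mul, mul_comm _ 2, pow_mul]
    norm_num
  · by_contra! hmixed
    obtain ⟨⟨u, hu, hneg⟩, u', hu', hpos⟩ := hmixed
    exact hk (mem_biUnion.2 ⟨(u, u'), mem_product.2 ⟨hu, hu'⟩,
      (mem_filter_univ k).2 (mul_neg_of_neg_of_pos hneg hpos)⟩)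

lemma exists_box (P : Finset α) (v : α → V) :
    ∃ b : Fin (finrank ℝ V) × Bool → V →ᵃ[ℝ] ℝ,
      (∀ j, ∀ p ∈ P, 1 ≤ b j (v p)) ∧ ∀ w ≠ 0, ∃ j, (b j).linear w < 0 := by
  set x := (finBasis ℝ V).coord
  obtain ⟨M, hM⟩ := ((P ×ˢ univ).image fun pj => |x pj.2 (v pj.1)|).exists_le
  have hxM : ∀ j, ∀ p ∈ P, |x j (v p)| ≤ M := fun j p hp =>
    hM _ (mem_image.2 ⟨(p, j), mem_product.2 ⟨hp, mem_univ j⟩, rfl⟩)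
  refine ⟨fun jε => (if jε.2 then x jε.1 else -x jε.1).toAffineMap +
    AffineMap.const ℝ V (M + 1), ?_, fun w hw => ?_⟩
  · rintro ⟨j, _ | _⟩ p hp
    · have : (1 : ℝ) ≤ -x j (v p) + (M + 1) := by linarith [le_abs_self (x j (v p)), hxM j p hp]
      simpa using this
    · have : (1 : ℝ) ≤ x j (v p) + (M + 1) := by linarith [neg_abs_le (x j (v p)), hxM j p hp]
      simpa using this
  · obtain ⟨j, hj⟩ : ∃ j, x j w ≠ 0 := by
      by_contra! h0
      exact hw ((finBasis ℝ V).forall_coord_eq_zero_iff.1 h0)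
    rcases lt_or_gt_of_ne hj with hj | hj
    · exact ⟨(j, true), by simpa using hj⟩
    · exact ⟨(j, false), by simpa using hj⟩

lemma exists_large_fiber {P : Finset α} (hP : P.Nonempty) {𝒯 : Finset β} [DecidableEq β]
    {f : α → β} (hf : ∀ p ∈ P, f p ∈ 𝒯) : ∃ τ ∈ 𝒯, #P ≤ #{p ∈ P | f p = τ} * #𝒯 := by
  obtain ⟨τ, hτ, hmax⟩ := exists_max_image 𝒯 (fun τ => #{p ∈ P | f p = τ})
    (let ⟨p, hp⟩ := hP; ⟨f p, hf p hp⟩)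
  refine ⟨τ, hτ, ?_⟩
  rw [card_eq_sum_card_fiberwise hf, mul_comm, ← smul_eq_mul]
  exact sum_le_card_nsmul _ _ _ hmax

lemma pos_of_abs_sub_lt {x y ε : ℝ} (hxy : |y - x| < ε) (hx : ε < |x|) (hy : 0 ≤ y) : 0 < x := by
  by_contra! hx0
  rw [abs_of_nonpos hx0] at hx
  linarith [le_abs_self (y - x)]

open Filter Topology in
/-- The arrangement is perturbed to a simple one without changing the sides of the points; then
the best piece of a cutting is chosen. -/
theorem exists_low_crossing_subset [Fintype κ] [Nonempty κ] (h : κ → V →ᵃ[ℝ] ℝ) (v : α → V)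
    {P : Finset α} (hP : P.Nonempty) (hne : ∀ k, ∀ p ∈ P, h k (v p) ≠ 0) {δ : ℝ} (hδ0 : 0 ≤ δ)
    (hδ1 : δ ≤ 1) {s : ℕ} (hs : (1 - δ) ^ s *
      (((Fintype.card κ + 2 * finrank ℝ V : ℕ) : ℝ) ^ finrank ℝ V) ^ 2 < 1) :
    ∃ B ⊆ P, #P ≤ #B * ((s + 2 * finrank ℝ V) ^ finrank ℝ V * 3 ^ finrank ℝ V) ∧
      ∃ X : Finset κ, #X ≤ 9 ^ finrank ℝ V * (δ * Fintype.card κ) ∧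
        ∀ k ∉ X, (∀ p ∈ B, 0 < h k (v p)) ∨ ∀ p ∈ B, h k (v p) < 0 := by
  classical
  obtain ⟨b, hb, hbw⟩ := exists_box P v
  have hgap : ∀ᶠ ε in 𝓝[>] (0 : ℝ), ∀ k, ∀ p ∈ P, ε < |h k (v p)| :=
    eventually_all.2 fun k => (eventually_all_finset P).2 fun p hp =>
      nhdsWithin_le_nhds (eventually_lt_nhds (abs_pos.2 (hne k p hp)))
  obtain ⟨ε, ⟨hε, hε1⟩, hε0⟩ := ((hgap.and (nhdsWithin_le_nhds (eventually_lt_nhds one_pos))).and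
    self_mem_nhdsWithin).exists
  obtain ⟨h', hlin, hnear, hsimple⟩ := exists_isSimpleArrangement_near (Sum.elim h b) hε0
  have hbox_card : Fintype.card (Fin (finrank ℝ V) × Bool) = 2 * finrank ℝ V := by simp [mul_comm]
  obtain ⟨𝒯, h𝒯_card, hcover, h𝒯⟩ := hsimple.exists_cutting (s := s)
    (fun w hw => (hbw w hw).imp fun j hj => by rwa [hlin]) hδ0 hδ1 (by rwa [hbox_card])
  have hcover' : ∀ p ∈ P, ∃ τ ∈ 𝒯, v p ∈ convexHull ℝ (τ : Set V) := fun p hp =>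
    hcover _ fun j => by
      have hnear_j : |h' (Sum.inr j) (v p) - b j (v p)| < ε := hnear (Sum.inr j) (v p)
      linarith [(abs_lt.1 hnear_j).1, hb j p hp]
  choose! τ hτ hvτ using hcover'
  obtain ⟨τ₀, hτ₀, hfiber⟩ := exists_large_fiber hP hτ
  obtain ⟨X, hX_card, hX⟩ := h𝒯 τ₀ hτ₀
  rw [hbox_card] at h𝒯_card
  refine ⟨{p ∈ P | τ p = τ₀}, filter_subset _ _,
    hfiber.trans (Nat.mul_le_mul_left _ h𝒯_card), X, hX_card, fun k hk => ?_⟩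
  have hmem : ∀ p ∈ ({p ∈ P | τ p = τ₀} : Finset α), p ∈ P ∧ v p ∈ convexHull ℝ (τ₀ : Set V) :=
    fun p hp => have hp := mem_filter.1 hp; ⟨hp.1, hp.2 ▸ hvτ p hp.1⟩
  refine (hX k hk).imp (fun hside p hp => ?_) fun hside p hp => ?_
  · have hpos : 0 ≤ h' (Sum.inl k) (v p) := convexHull_min (fun u hu => hside u hu)
      ((convex_Ici (0 : ℝ)).affine_preimage (h' (Sum.inl k))) (hmem p hp).2
    exact pos_of_abs_sub_lt (hnear (Sum.inl k) (v p)) (hε k p (hmem p hp).1) hpos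
  · have hneg : h' (Sum.inl k) (v p) ≤ 0 := convexHull_min (fun u hu => hside u hu)
      ((convex_Iic (0 : ℝ)).affine_preimage (h' (Sum.inl k))) (hmem p hp).2
    have := pos_of_abs_sub_lt (x := -h k (v p)) (y := -h' (Sum.inl k) (v p))
      (by rw [neg_sub_neg, abs_sub_comm]; exact hnear (Sum.inl k) (v p))
      (by rw [abs_neg]; exact hε k p (hmem p hp).1) (neg_nonneg.2 hneg)
    exact neg_pos.1 this

end Cuttings

section AvoidingPairs

lemma exists_card_filter_subset_le [DecidableEq α] {Q : Finset α} {d r : ℕ} (hdr : d ≤ r)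
    (hr : r ≤ #Q) {𝒳 : Finset (Finset α)} (h𝒳 : 𝒳 ⊆ powersetCard d Q) {η : ℝ}
    (hη : #𝒳 ≤ η * (#Q).choose d) :
    ∃ R ⊆ Q, #R = r ∧ #{D ∈ 𝒳 | D ⊆ R} ≤ η * r.choose d := by
  by_contra! hlt
  have hcount := sum_card_bipartiteAbove_eq_sum_card_bipartiteBelow (s := powersetCard r Q)
    (t := 𝒳) (fun R D => D ⊆ R)
  simp only [bipartiteAbove, bipartiteBelow] at hcount
  have hsupersets : ∀ D ∈ 𝒳, #{R ∈ powersetCard r Q | D ⊆ R} = (#Q - d).choose (r - d) := by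
    intro D hD
    obtain ⟨hDQ, hDd⟩ := mem_powersetCard.1 (h𝒳 hD)
    rw [card_filter_powersetCard_subset D Q r hDQ (by omega), hDd]
  rw [sum_congr rfl hsupersets, sum_const, smul_eq_mul] at hcount
  have hsum : (#Q).choose r * (η * r.choose d) < #𝒳 * (#Q - d).choose (r - d) := by
    have := sum_lt_sum_of_nonempty (powersetCard_nonempty.2 hr) fun R hR =>
      hlt R (mem_powersetCard.1 hR).1 (mem_powersetCard.1 hR).2
    rw [sum_const, card_powersetCard, nsmul_eq_mul, ← Nat.cast_sum, hcount] at this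
    exact_mod_cast this
  have hchoose : ((#Q).choose r : ℝ) * r.choose d = (#Q).choose d * (#Q - d).choose (r - d) :=
    mod_cast Nat.choose_mul hdr
  refine hsum.not_ge ?_
  calc (#𝒳 : ℝ) * (#Q - d).choose (r - d)
      ≤ η * (#Q).choose d * (#Q - d).choose (r - d) := by gcongr
    _ = (#Q).choose r * (η * r.choose d) := by linear_combination -η * hchoose

/-- Deletion method: remove one element of each edge inside a random `2 * m`-element set. -/
lemma exists_independent_subset {Q : Finset α} {d m : ℕ} (hd : 1 ≤ d) (hdm : d ≤ 2 * m)
    (hm : 2 * m ≤ #Q) {𝒳 : Finset (Finset α)} (h𝒳 : 𝒳 ⊆ powersetCard d Q) {η : ℝ} (hη0 : 0 ≤ η)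
    (hη : #𝒳 ≤ η * (#Q).choose d) (hηm : η * (2 * m : ℝ) ^ d ≤ m) :
    ∃ A ⊆ Q, m ≤ #A ∧ ∀ D ∈ 𝒳, ¬D ⊆ A := by
  classical
  obtain ⟨R, hRQ, hR, hle⟩ := exists_card_filter_subset_le hdm hm h𝒳 hη
  have hfew : #{D ∈ 𝒳 | D ⊆ R} ≤ m := by
    have hchoose : ((2 * m).choose d : ℝ) ≤ (2 * m : ℝ) ^ d := mod_cast Nat.choose_le_pow (2 * m) d
    exact_mod_cast hle.trans ((mul_le_mul_of_nonneg_left hchoose hη0).trans hηm)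
  have hnonempty : ∀ D ∈ 𝒳, ∃ i, i ∈ D := fun D hD =>
    card_pos.1 (by rw [(mem_powersetCard.1 (h𝒳 hD)).2]; exact hd)
  have : Nonempty α := ⟨(card_pos.1 (by omega : 0 < #R)).choose⟩
  choose! pick hpick using hnonempty
  refine ⟨R \ image pick {D ∈ 𝒳 | D ⊆ R}, sdiff_subset.trans hRQ, ?_, fun D hD hDA => ?_⟩
  · have := le_card_sdiff (image pick {D ∈ 𝒳 | D ⊆ R}) R
    have := (card_image_le (s := {D ∈ 𝒳 | D ⊆ R}) (f := pick)).trans hfew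
    omega
  · exact (mem_sdiff.1 (hDA (hpick D hD))).2
      (mem_image_of_mem _ (mem_filter.2 ⟨hD, hDA.trans sdiff_subset⟩))

variable {E V : Type*} [AddCommGroup E] [Module ℝ E] [AddCommGroup V] [Module ℝ V]

lemma exists_affineMap_apply_eq (g : Dual ℝ (V × ℝ)) :
    ∃ h : V →ᵃ[ℝ] ℝ, ∀ x, h x = g (x, 1) :=
  ⟨(g ∘ₗ LinearMap.inl ℝ V ℝ).toAffineMap + AffineMap.const ℝ V (g (0, 1)), fun x => by
    simp [← map_add]⟩

variable [FiniteDimensional ℝ E] [FiniteDimensional ℝ V]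

lemma exists_dual_ne_zero_of_card_lt (u : α → E) {D : Finset α} (hD : #D < finrank ℝ E) :
    ∃ g : Dual ℝ E, g ≠ 0 ∧ ∀ i ∈ D, g (u i) = 0 := by
  have hker : LinearMap.ker (LinearMap.pi fun i : D => Dual.eval ℝ E (u i)) ≠ ⊥ :=
    LinearMap.ker_ne_bot_of_finrank_lt (by simpa [Subspace.dual_finrank_eq] using hD)
  obtain ⟨g, hg, hg0⟩ := (Submodule.ne_bot_iff _).1 hker
  exact ⟨g, hg0, fun i hi => congrFun (LinearMap.mem_ker.1 hg) ⟨i, hi⟩⟩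

lemma IsGeneric.exists_dual_eq_zero_iff {u : α → E} {P D : Finset α} (h : IsGeneric u P)
    (hD : D ⊆ P) (hcard : #D + 1 = finrank ℝ E) :
    ∃ g : Dual ℝ E, ∀ i ∈ P, g (u i) = 0 ↔ i ∈ D := by
  classical
  obtain ⟨g, hg0, hgD⟩ := exists_dual_ne_zero_of_card_lt u (by omega : #D < finrank ℝ E)
  refine ⟨g, fun p hp => ⟨fun hgp => ?_, hgD p⟩⟩
  by_contra hpD
  have hspan := (h.mono (insert_subset hp hD)).span_eq_top
    (by rw [card_insert_of_notMem hpD, hcard])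
  have hle : Submodule.span ℝ (u '' (insert p D : Finset α)) ≤ LinearMap.ker g := by
    rw [Submodule.span_le]
    rintro _ ⟨i, hi, rfl⟩
    rcases mem_insert.1 hi with rfl | hi
    · exact hgp
    · exact hgD i hi
  exact hg0 (LinearMap.ker_eq_top.1 (top_unique (hspan ▸ hle)))

/-- The hyperplanes spanned by `Hi` rarely meet the convex hull of a suitable `B ⊆ Lo`; an
independent set `A` of the hypergraph of bad `d`-tuples spans none of the exceptions. -/
theorem exists_avoids_subsets {v : α → V} {P Lo Hi : Finset α} (h : IsGeneric (homogenize v) P)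
    (hV : 1 ≤ finrank ℝ V) (hLo : Lo ⊆ P) (hHi : Hi ⊆ P) (hdisj : Disjoint Hi Lo)
    (hLo_ne : Lo.Nonempty) {m s : ℕ} {δ : ℝ} (hδ0 : 0 ≤ δ) (hδ1 : δ ≤ 1)
    (hs : (1 - δ) ^ s * (((#Hi ^ finrank ℝ V + 2 * finrank ℝ V : ℕ) : ℝ) ^ finrank ℝ V) ^ 2 < 1)
    (hδm : 9 ^ finrank ℝ V * δ * (2 * m : ℝ) ^ finrank ℝ V ≤ m) (hm : 2 * m ≤ #Hi)
    (hdm : finrank ℝ V ≤ 2 * m) :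
    ∃ A ⊆ Hi, ∃ B ⊆ Lo, m ≤ #A ∧
      #Lo ≤ #B * ((s + 2 * finrank ℝ V) ^ finrank ℝ V * 3 ^ finrank ℝ V) ∧
      Avoids (homogenize v) A B := by
  classical
  set d := finrank ℝ V
  have hfinrank : finrank ℝ (V × ℝ) = d + 1 := by rw [finrank_prod, finrank_self]
  have : Nonempty (powersetCard d Hi) := (powersetCard_nonempty.2 (hdm.trans hm)).to_subtype
  have hplane : ∀ D : powersetCard d Hi, ∃ h : V →ᵃ[ℝ] ℝ, ∃ g : Dual ℝ (V × ℝ),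
      (∀ x, h x = g (x, 1)) ∧ ∀ p ∈ P, g (homogenize v p) = 0 ↔ p ∈ D.1 := by
    rintro ⟨D, hD⟩
    obtain ⟨hDHi, hDd⟩ := mem_powersetCard.1 hD
    obtain ⟨g, hg⟩ := h.exists_dual_eq_zero_iff (hDHi.trans hHi) (by rw [hDd, hfinrank])
    exact (exists_affineMap_apply_eq g).imp fun _ hh => ⟨g, hh, hg⟩
  choose h g hhg hg using hplane
  have hcardκ : Fintype.card (powersetCard d Hi) = (#Hi).choose d := by
    rw [Fintype.card_coe, card_powersetCard]
  have hκ_le : Fintype.card (powersetCard d Hi) ≤ #Hi ^ d := hcardκ.trans_le (Nat.choose_le_pow _ _)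
  obtain ⟨B, hB, hBcard, X, hXcard, hX⟩ := exists_low_crossing_subset h v hLo_ne
    (fun D p hp hzero => disjoint_left.1 hdisj ((mem_powersetCard.1 D.2).1
      ((hg D p (hLo hp)).1 ((hhg D _).symm.trans hzero))) hp) hδ0 hδ1 (s := s) (by
      refine lt_of_le_of_lt (mul_le_mul_of_nonneg_left ?_ (pow_nonneg (sub_nonneg.2 hδ1) s)) hs
      gcongr)
  obtain ⟨A, hA, hmA, hAX⟩ := exists_independent_subset hV hdm hm
    (𝒳 := X.map (Function.Embedding.subtype _)) (fun D hD => property_of_mem_map_subtype X hD)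
    (by positivity) (by rw [card_map, ← hcardκ, mul_assoc]; exact hXcard) hδm
  refine ⟨A, hA, B, hB, hmA, hBcard, fun D hD hDcard => ?_⟩
  have hDmem : D ∈ powersetCard d Hi := mem_powersetCard.2 ⟨hD.trans hA, by omega⟩
  have hDX : ⟨D, hDmem⟩ ∉ X := fun hmem => hAX D (mem_map_of_mem _ hmem) hD
  have hgD : ∀ i ∈ D, g ⟨D, hDmem⟩ (homogenize v i) = 0 := fun i hi =>
    (hg ⟨D, hDmem⟩ i (hHi (hA (hD hi)))).2 hi
  rcases hX _ hDX with hpos | hneg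
  · exact ⟨g ⟨D, hDmem⟩, hgD, fun b hb => (hhg ⟨D, hDmem⟩ _).symm ▸ hpos b hb⟩
  · exact ⟨-g ⟨D, hDmem⟩, fun i hi => neg_eq_zero.2 (hgD i hi),
      fun b hb => neg_pos.2 ((hhg ⟨D, hDmem⟩ (v b)).symm ▸ hneg b hb)⟩

theorem exists_avoiding_pair {v : α → V} {P : Finset α} (h : IsGeneric (homogenize v) P)
    (hV : 1 ≤ finrank ℝ V) {m s : ℕ} {δ : ℝ} (hδ0 : 0 ≤ δ) (hδ1 : δ ≤ 1)
    (hs : (1 - δ) ^ s * (((#P ^ finrank ℝ V + 2 * finrank ℝ V : ℕ) : ℝ) ^ finrank ℝ V) ^ 2 < 1)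
    (hδm : 9 ^ finrank ℝ V * δ * (2 * m : ℝ) ^ finrank ℝ V ≤ m) (hm : 4 * m ≤ #P)
    (hdm : finrank ℝ V ≤ 2 * m) :
    ∃ A ⊆ P, ∃ B ⊆ P, ∃ f : Dual ℝ V, (∀ a ∈ A, ∀ b ∈ B, f (v b) < f (v a)) ∧ m ≤ #A ∧
      #P / 2 ≤ #B * ((s + 2 * finrank ℝ V) ^ finrank ℝ V * 3 ^ finrank ℝ V) ∧
      Avoids (homogenize v) A B := by
  classical
  obtain ⟨f, hf⟩ := exists_dual_injOn (h.injOn_of_homogenize hV)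
  obtain ⟨Lo, hLo, hLo_card, hlt⟩ := exists_initial_subset (fun i => f (v i)) hf
    (Nat.div_le_self #P 2)
  have hHi_card : #(P \ Lo) = #P - #P / 2 := by rw [card_sdiff_of_subset hLo, hLo_card]
  obtain ⟨A, hA, B, hB, hmA, hLoB, hAB⟩ := exists_avoids_subsets h hV hLo sdiff_subset
    sdiff_disjoint (card_pos.1 (by omega)) hδ0 hδ1 (s := s) (by
      refine lt_of_le_of_lt (mul_le_mul_of_nonneg_left ?_ (pow_nonneg (sub_nonneg.2 hδ1) s)) hs
      gcongr
      exact sdiff_subset) hδm (by omega) hdm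
  refine ⟨A, hA.trans sdiff_subset, B, hB.trans hLo, f, fun a ha b hb => ?_, hmA, ?_, hAB⟩
  · obtain ⟨haP, haLo⟩ := mem_sdiff.1 (hA ha)
    exact hlt b (hB hb) a haP haLo
  · rwa [← hLo_card]

end AvoidingPairs

section Recursion

open Filter

lemma one_sub_pow_mul_lt_one {δ L N : ℝ} {s : ℕ} (hδ : δ ≤ 1) (hs : L < δ * s)
    (hN : N ≤ Real.exp L) : (1 - δ) ^ s * N < 1 := by
  have hpow : (1 - δ) ^ s ≤ Real.exp (-(δ * s)) := by
    calc (1 - δ) ^ s ≤ Real.exp (-δ) ^ s :=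
          pow_le_pow_left₀ (sub_nonneg.2 hδ) (Real.one_sub_le_exp_neg δ) s
      _ = Real.exp (-(δ * s)) := by
          rw [← Real.exp_nat_mul]
          ring_nf
  calc (1 - δ) ^ s * N ≤ Real.exp (-(δ * s)) * Real.exp L := by
        have := pow_nonneg (sub_nonneg.2 hδ) s
        exact (mul_le_mul_of_nonneg_left hN this).trans
          (mul_le_mul_of_nonneg_right hpow (Real.exp_pos L).le)
    _ < 1 := by
        rw [← Real.exp_add, Real.exp_lt_one_iff]
        linarith

lemma pow_add_two_mul_pow_sq_le_exp {k n : ℕ} (hk : 1 ≤ k) (hn : 3 ≤ n) (hkn : k ≤ n) :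
    (((n ^ k + 2 * k : ℕ) : ℝ) ^ k) ^ 2 ≤ Real.exp (2 * k * (k + 1) * Real.log n) := by
  have hle : n ^ k + 2 * k ≤ n ^ (k + 1) := by
    have := Nat.le_self_pow (by omega : k ≠ 0) n
    rw [pow_succ]
    nlinarith
  have hexp : Real.exp (2 * k * (k + 1) * Real.log n) = (((n : ℝ) ^ (k + 1)) ^ k) ^ 2 := by
    rw [← pow_mul, ← pow_mul, mul_comm, Real.exp_mul, Real.exp_log (by positivity),
      ← Real.rpow_natCast]
    push_cast
    ring_nf
  rw [hexp]
  gcongr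
  exact_mod_cast hle

/-- The sample size `s` and threshold `δ` for which `exists_avoiding_pair` yields `m` points on one
side; the last bound controls the loss on the other side. -/
lemma exists_sampling_parameters {k : ℕ} (hk : 1 ≤ k) :
    ∃ C : ℝ, 0 < C ∧ ∀ n m : ℕ, 3 ≤ n → k ≤ n → 1 ≤ m → ∃ (s : ℕ) (δ : ℝ), 0 ≤ δ ∧ δ ≤ 1 ∧
      (1 - δ) ^ s * (((n ^ k + 2 * k : ℕ) : ℝ) ^ k) ^ 2 < 1 ∧
      9 ^ k * δ * (2 * m : ℝ) ^ k ≤ m ∧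
      (((s + 2 * k) ^ k * 3 ^ k : ℕ) : ℝ) ≤ C * ((m : ℝ) ^ (k - 1) * Real.log n) ^ k := by
  set K : ℝ := 9 ^ k * 2 ^ k with hK
  have hK1 : 1 ≤ K := one_le_mul_of_one_le_of_one_le (one_le_pow₀ (by norm_num))
    (one_le_pow₀ (by norm_num))
  set C₁ : ℝ := 2 * k * (k + 1) * K + 1 + 2 * k with hC₁
  refine ⟨C₁ ^ k * 3 ^ k, by positivity, fun n m hn hkn hm => ?_⟩
  have hL : 1 ≤ Real.log n := by
    rw [Real.le_log_iff_exp_le (by positivity)]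
    have : (3 : ℝ) ≤ n := by exact_mod_cast hn
    linarith [Real.exp_one_lt_d9]
  set L := Real.log n
  set M := (m : ℝ) ^ (k - 1) with hM
  have hM1 : 1 ≤ M := one_le_pow₀ (by exact_mod_cast hm)
  have hKM : 1 ≤ K * M := one_le_mul_of_one_le_of_one_le hK1 hM1
  set s := ⌊2 * k * (k + 1) * L * (K * M)⌋₊ + 1 with hs
  have hδ : 1 / (K * M) ≤ 1 := (div_le_one (by positivity)).2 hKM
  refine ⟨s, 1 / (K * M), by positivity, hδ, ?_, ?_, ?_⟩
  · refine one_sub_pow_mul_lt_one hδ ?_ (pow_add_two_mul_pow_sq_le_exp hk hn hkn)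
    rw [one_div_mul_eq_div, lt_div_iff₀ (by positivity), hs]
    exact_mod_cast Nat.lt_floor_add_one _
  · have hmk : (m : ℝ) ^ k = M * m := by rw [hM, ← pow_succ, Nat.sub_add_cancel hk]
    rw [mul_pow, hmk, hK]
    apply le_of_eq
    field_simp
  · have hML : 1 ≤ M * L := one_le_mul_of_one_le_of_one_le hM1 hL
    have hs_le : (s + 2 * k : ℝ) ≤ C₁ * (M * L) := by
      have hfloor : (⌊2 * k * (k + 1) * L * (K * M)⌋₊ : ℝ) ≤ 2 * k * (k + 1) * L * (K * M) :=
        Nat.floor_le (by positivity)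
      have hrest : (1 + 2 * k : ℝ) ≤ (1 + 2 * k) * (M * L) :=
        le_mul_of_one_le_right (by positivity) hML
      rw [hs, hC₁]
      push_cast
      linarith
    push_cast
    calc (s + 2 * k : ℝ) ^ k * 3 ^ k ≤ (C₁ * (M * L)) ^ k * 3 ^ k := by gcongr
      _ = C₁ ^ k * 3 ^ k * (M * L) ^ k := by rw [mul_pow, mul_right_comm]

lemma eventually_mul_log_pow_le (C : ℝ) (k : ℕ) {t : ℝ} (ht : 0 < t) :
    ∀ᶠ n : ℕ in atTop, C * Real.log n ^ k ≤ (n : ℝ) ^ t := by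
  have hlittle := ((isLittleO_log_rpow_rpow_atTop (k : ℝ) ht).const_mul_left C).bound one_pos
  filter_upwards [tendsto_natCast_atTop_atTop.eventually hlittle] with n hn
  rw [Real.rpow_natCast, one_mul, Real.norm_of_nonneg (by positivity : 0 ≤ (n : ℝ) ^ t)] at hn
  exact (le_abs_self _).trans hn

lemma rpow_le_of_half_le {x ℓ C e : ℝ} {d n m b : ℕ} (hx : 0 < x) (hℓ : 0 < ℓ) (hC : 0 < C)
    (hxn : x ^ (d * (d + 1) + 1) = n) (hmx : m ≤ x) (hn : 2 ≤ n)
    (hlog : 3 * C * ℓ ^ (d + 1) ≤ x ^ (1 - e))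
    (hb : ((n / 2 : ℕ) : ℝ) ≤ b * (C * ((m : ℝ) ^ d * ℓ) ^ (d + 1))) : x ^ e ≤ b := by
  have hpos : 0 < x ^ (d * (d + 1)) * x ^ (1 - e) := by positivity
  refine le_of_mul_le_mul_right ?_ hpos
  have hhalf : (n : ℝ) ≤ 3 * ((n / 2 : ℕ) : ℝ) := by exact_mod_cast (by omega : n ≤ 3 * (n / 2))
  have hsplit : x ^ e * x ^ (1 - e) = x := by
    rw [← Real.rpow_add hx, add_sub_cancel, Real.rpow_one]
  calc x ^ e * (x ^ (d * (d + 1)) * x ^ (1 - e)) = n := by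
        rw [mul_left_comm, hsplit, ← pow_succ, hxn]
    _ ≤ 3 * (b * (C * ((m : ℝ) ^ d * ℓ) ^ (d + 1))) := by linarith
    _ ≤ 3 * (b * (C * (x ^ d * ℓ) ^ (d + 1))) := by gcongr
    _ = b * (x ^ (d * (d + 1)) * (3 * C * ℓ ^ (d + 1))) := by
        rw [mul_pow, ← pow_mul]
        ring
    _ ≤ b * (x ^ (d * (d + 1)) * x ^ (1 - e)) := by gcongr

lemma eventually_exists_sampling_parameters {d D : ℕ} (hd : 1 ≤ d) (hD : D = d * (d + 1) + 1)
    {e : ℝ} (he : e < 1) :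
    ∀ᶠ n : ℕ in atTop, ∃ (m s : ℕ) (δ : ℝ), 0 ≤ δ ∧ δ ≤ 1 ∧
      (1 - δ) ^ s * (((n ^ (d + 1) + 2 * (d + 1) : ℕ) : ℝ) ^ (d + 1)) ^ 2 < 1 ∧
      9 ^ (d + 1) * δ * (2 * m : ℝ) ^ (d + 1) ≤ m ∧ 4 * m ≤ n ∧ d < m ∧
      (n : ℝ) ^ (1 / D : ℝ) / 2 ≤ m ∧
      ∀ b : ℕ, n / 2 ≤ b * ((s + 2 * (d + 1)) ^ (d + 1) * 3 ^ (d + 1)) →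
        ((n : ℝ) ^ (1 / D : ℝ)) ^ e ≤ b := by
  obtain ⟨C, hC, hparam⟩ := exists_sampling_parameters (by omega : 1 ≤ d + 1)
  have hD0 : (0 : ℝ) < D := by rw [hD]; positivity
  have hlarge : ∀ᶠ n : ℕ in atTop, (d + 4 : ℝ) ≤ (n : ℝ) ^ (1 / D : ℝ) :=
    ((tendsto_rpow_atTop (one_div_pos.2 hD0)).comp
      tendsto_natCast_atTop_atTop).eventually_ge_atTop _
  filter_upwards [eventually_mul_log_pow_le (3 * C) (d + 1) (div_pos (sub_pos.2 he) hD0), hlarge]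
    with n hlog hx
  rw [← one_div_mul_eq_div, Real.rpow_mul (by positivity)] at hlog
  have hxn : ((n : ℝ) ^ (1 / D : ℝ)) ^ D = n := by
    rw [← Real.rpow_natCast, ← Real.rpow_mul (by positivity), one_div_mul_cancel hD0.ne',
      Real.rpow_one]
  set x := (n : ℝ) ^ (1 / D : ℝ)
  have hx4 : 4 ≤ x := by linarith [d.cast_nonneg (α := ℝ)]
  have hx0 : 0 < x := by linarith
  have hmx : (⌊x⌋₊ : ℝ) ≤ x := Nat.floor_le hx0.le
  have hxm : x < ⌊x⌋₊ + 1 := Nat.lt_floor_add_one x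
  have hdm : d + 4 ≤ ⌊x⌋₊ := Nat.le_floor (by exact_mod_cast hx)
  have hmn : 4 * ⌊x⌋₊ ≤ n := by
    have hpow : x ^ 2 ≤ n := by
      rw [← hxn]
      exact pow_le_pow_right₀ (by linarith) (by rw [hD]; nlinarith)
    have : (4 * ⌊x⌋₊ : ℝ) ≤ n := by nlinarith [hx4]
    exact_mod_cast this
  obtain ⟨s, δ, hδ0, hδ1, hs, hδm, hsC⟩ := hparam n ⌊x⌋₊ (by omega) (by omega) (by omega)
  refine ⟨⌊x⌋₊, s, δ, hδ0, hδ1, hs, hδm, hmn, by omega, by linarith, fun b hb => ?_⟩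
  refine rpow_le_of_half_le hx0 (Real.log_pos (by exact_mod_cast (by omega : 1 < n))) hC
    (hD ▸ hxn) hmx (by omega) hlog ?_
  calc ((n / 2 : ℕ) : ℝ) ≤ b * (((s + 2 * (d + 1)) ^ (d + 1) * 3 ^ (d + 1) : ℕ) : ℝ) := by
        exact_mod_cast hb
    _ ≤ b * (C * ((⌊x⌋₊ : ℝ) ^ d * Real.log n) ^ (d + 1)) := by
        gcongr
        exact hsC

/-- Every configuration of `n > d` points in general position in `ℝ^d` has a crossing family of
size `Ω(n ^ e)`. The points are indexed, since the induction step projects them. -/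
def HasCrossingBound (d : ℕ) (e : ℝ) : Prop :=
  ∃ c : ℝ, 0 < c ∧ ∀ (α : Type) (v : α → EuclideanSpace ℝ (Fin d)) (P : Finset α),
    IsGeneric (homogenize v) P → d < #P →
      ∃ F, IsConeFamily (homogenize v) P d F ∧ c * (#P : ℝ) ^ e ≤ #F

lemma hasCrossingBound_two : HasCrossingBound 2 (1 / 2) := by
  refine ⟨1 / 15, by norm_num, fun α v P h hP => ?_⟩
  obtain ⟨F, hF, hF_card⟩ := exists_isConeFamily_of_finrank_eq_two (by simp) h hP
  refine ⟨F, hF, ?_⟩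
  rw [← Real.sqrt_eq_rpow]
  linarith

lemma HasCrossingBound.of_le_card {d N : ℕ} {e c : ℝ} (he : e ≤ 1) (hc : 0 < c)
    (h : ∀ (α : Type) (v : α → EuclideanSpace ℝ (Fin d)) (P : Finset α),
      IsGeneric (homogenize v) P → N ≤ #P →
        ∃ F, IsConeFamily (homogenize v) P d F ∧ c * (#P : ℝ) ^ e ≤ #F) :
    HasCrossingBound d e := by
  refine ⟨min c (1 / (N + 1)), by positivity, fun α v P hP hcard => ?_⟩
  rcases le_or_gt N #P with hN | hN
  · obtain ⟨F, hF, hF_card⟩ := h α v P hP hN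
    exact ⟨F, hF, hF_card.trans' (by gcongr; exact min_le_left _ _)⟩
  · obtain ⟨s, hs, rfl⟩ := exists_subset_card_eq hcard.le
    refine ⟨{s}, .singleton _ hs, ?_⟩
    have hP1 : (1 : ℝ) ≤ #P := by exact_mod_cast (by omega : 1 ≤ #P)
    have hPN : (#P : ℝ) ≤ N + 1 := by exact_mod_cast (by omega : #P ≤ N + 1)
    calc min c (1 / (N + 1)) * (#P : ℝ) ^ e ≤ 1 / (N + 1) * (N + 1) := by
          gcongr
          · exact min_le_right _ _
          · exact (Real.rpow_le_self_of_one_le hP1 he).trans hPN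
      _ = #{s} := by
          rw [one_div_mul_cancel (by positivity), card_singleton, Nat.cast_one]

lemma min_mul_rpow_le_min {x e c a b : ℝ} (hx : 0 ≤ x) (he0 : 0 ≤ e) (he1 : e ≤ 1) (hc : 0 ≤ c)
    (ha : x / 2 ≤ a) (hb : x ^ e ≤ b) : min (c / 2) 1 * x ^ e ≤ min (c * a ^ e) b := by
  have hhalf : 1 / 2 * x ^ e ≤ a ^ e := by
    calc 1 / 2 * x ^ e ≤ (1 / 2) ^ e * x ^ e := by
          gcongr
          exact Real.self_le_rpow_of_le_one (by norm_num) (by norm_num) he1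
      _ = (x / 2) ^ e := by rw [← Real.mul_rpow (by norm_num) hx, one_div_mul_eq_div]
      _ ≤ a ^ e := by gcongr
  rw [min_mul_of_nonneg _ _ (by positivity), one_mul]
  exact min_le_min (by nlinarith) hb

theorem HasCrossingBound.succ {d : ℕ} (hd : 2 ≤ d) {e : ℝ} (he0 : 0 < e) (he : e ≤ 1 / 2)
    (h : HasCrossingBound d e) :
    HasCrossingBound (d + 1) (e / (((d + 1 : ℕ) : ℝ) ^ 2 - ((d + 1 : ℕ) : ℝ) + 1)) := by
  obtain ⟨c, hc, hproj⟩ := h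
  obtain ⟨D, hD⟩ : ∃ D, D = d * (d + 1) + 1 := ⟨_, rfl⟩
  have hD_cast : ((d + 1 : ℕ) : ℝ) ^ 2 - ((d + 1 : ℕ) : ℝ) + 1 = D := by
    rw [hD]
    push_cast
    ring
  have hD1 : (1 : ℝ) ≤ D := by exact_mod_cast (by omega : 1 ≤ D)
  obtain ⟨N, hN⟩ := eventually_atTop.1 <|
    eventually_exists_sampling_parameters (by omega : 1 ≤ d) hD (by linarith : e < 1)
  rw [hD_cast]
  refine .of_le_card (N := max N 1) (c := min (c / 2) 1)
    ((div_le_one (by positivity)).2 (by linarith)) (by positivity) fun α v P hP hP_card => ?_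
  obtain ⟨m, s, δ, hδ0, hδ1, hs, hδm, hm, hdm, hxm, hxb⟩ := hN #P (by omega)
  have hrank : finrank ℝ (EuclideanSpace ℝ (Fin (d + 1))) = d + 1 := finrank_euclideanSpace_fin
  obtain ⟨A, hA, B, hB, f, hf, hAm, hB_card, hAB⟩ :=
    exists_avoiding_pair hP (by omega) hδ0 hδ1 (by rwa [hrank]) (by rwa [hrank]) hm (by omega)
  rw [hrank] at hB_card
  have hpow : (#P : ℝ) ^ (e / D) = ((#P : ℝ) ^ (1 / D : ℝ)) ^ e := by
    rw [← one_div_mul_eq_div, Real.rpow_mul (by positivity)]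
  rw [hpow]
  have hx : 0 < (#P : ℝ) ^ (1 / D : ℝ) := by
    have : 0 < #P := by omega
    positivity
  set x := (#P : ℝ) ^ (1 / D : ℝ)
  have hxB : x ^ e ≤ #B := hxb #B hB_card
  have hB_pos : 0 < #B := by exact_mod_cast (Real.rpow_pos_of_pos hx e).trans_le hxB
  obtain ⟨v', hv', hlift⟩ := hAB.exists_projection (V' := EuclideanSpace ℝ (Fin d)) (by simp)
    (by simpa using hd) hP hA hB (card_pos.1 (by omega)) (card_pos.1 hB_pos) hf
  rw [hrank, finrank_euclideanSpace_fin] at hlift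
  obtain ⟨F, hF, hF_card⟩ := hproj α v' A hv' (by omega)
  obtain ⟨F', hF', hF'_card⟩ := hlift F hF
  refine ⟨F', hF', ?_⟩
  rw [hF'_card, Nat.cast_min]
  exact (min_mul_rpow_le_min hx.le he0.le (by linarith) hc.le
    (hxm.trans (by exact_mod_cast hAm)) hxB).trans (min_le_min_right _ hF_card)

theorem hasCrossingBound {d : ℕ} (hd : 2 ≤ d) :
    HasCrossingBound d ((1 : ℝ) / (2 * ∏ i ∈ Icc 3 d, ((i : ℝ) ^ 2 - (i : ℝ) + 1))) := by
  induction d, hd using Nat.le_induction with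
  | base => simpa using hasCrossingBound_two
  | succ d hd ih =>
    have hprod : 1 ≤ ∏ i ∈ Icc 3 d, ((i : ℝ) ^ 2 - (i : ℝ) + 1) := by
      refine Finset.one_le_prod fun i hi => ?_
      have : (3 : ℝ) ≤ i := by exact_mod_cast (mem_Icc.1 hi).1
      nlinarith
    rw [prod_Icc_succ_top (by omega), ← mul_assoc, ← div_div]
    exact ih.succ hd (by positivity) (one_div_le_one_div_of_le two_pos (by linarith))

end Recursion

section Simplices

lemma exists_affineSubspace_of_dual {V : Type*} [AddCommGroup V] [Module ℝ V]
    [FiniteDimensional ℝ V] {g : Dual ℝ (V × ℝ)} (hg : g ≠ 0) {x₀ : V} (hx₀ : g (x₀, 1) = 0) :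
    ∃ H : AffineSubspace ℝ V, (H : Set V).Nonempty ∧ finrank ℝ H.direction + 1 = finrank ℝ V ∧
      ∀ x, g (x, 1) = 0 → x ∈ H := by
  set g' : Dual ℝ V := g ∘ₗ LinearMap.inl ℝ V ℝ with hg'
  have hsub : ∀ x y : V, ∀ r : ℝ, g (x, r) - g (y, r) = g' (x - y) := fun x y r => by
    rw [← map_sub, Prod.mk_sub_mk, sub_self, hg', LinearMap.comp_apply, LinearMap.inl_apply]
  have hg'0 : g' ≠ 0 := by
    intro h0
    refine hg (LinearMap.ext fun ⟨x, r⟩ => ?_)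
    have hr : g (r • x₀, r) = 0 := by
      rw [show (r • x₀, r) = r • (x₀, (1 : ℝ)) by simp, map_smul, hx₀, smul_zero]
    simpa [h0, hr] using hsub x (r • x₀) r
  refine ⟨AffineSubspace.mk' x₀ (LinearMap.ker g'), ⟨x₀, AffineSubspace.self_mem_mk' _ _⟩, ?_,
    fun x hx => ?_⟩
  · rw [AffineSubspace.direction_mk', Dual.finrank_ker_add_one_of_ne_zero hg'0]
  · rw [AffineSubspace.mem_mk', LinearMap.mem_ker, vsub_eq_sub, ← hsub x x₀ 1, hx, hx₀, sub_zero]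

lemma InGeneralPosition.isGeneric_homogenize {d : ℕ} {P : Finset (EuclideanSpace ℝ (Fin d))}
    (h : InGeneralPosition P) (hP : d < #P) : IsGeneric (homogenize id) P := by
  intro S hS hS_card
  have hrank : finrank ℝ (EuclideanSpace ℝ (Fin d) × ℝ) = d + 1 := by simp
  obtain ⟨T, hST, hTP, hT⟩ := exists_subsuperset_card_eq hS (hS_card.trans_eq hrank) hP
  refine LinearIndepOn.mono ?_ hST
  by_contra hdep
  have hspan : Submodule.span ℝ (homogenize id '' (T : Set (EuclideanSpace ℝ (Fin d)))) < ⊤ := by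
    refine lt_top_iff_ne_top.2 fun htop => hdep ?_
    refine linearIndependent_of_top_le_span_of_card_eq_finrank ?_ ?_
    · rw [← Set.image_eq_range]
      exact htop.ge
    · simp [hT]
  obtain ⟨g, hg0, hg⟩ := Submodule.exists_le_ker_of_lt_top _ hspan
  have hgT : ∀ x ∈ T, g (x, 1) = 0 := fun x hx =>
    hg (Submodule.subset_span ⟨x, hx, rfl⟩)
  obtain ⟨x₀, hx₀⟩ : T.Nonempty := card_pos.1 (by omega)
  obtain ⟨H, hH_ne, hH, hmem⟩ := exists_affineSubspace_of_dual hg0 (hgT x₀ hx₀)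
  rw [finrank_euclideanSpace_fin] at hH
  exact h T hTP hT ⟨H, hH_ne, hH, fun x hx => hmem x (hgT x hx)⟩

variable {V : Type*} [AddCommGroup V] [Module ℝ V] {s : Finset V} {m : ℕ}

lemma affineIndependent_of_linearIndepOn_homogenize
    (hs : LinearIndepOn ℝ (homogenize id) (s : Set V)) :
    AffineIndependent ℝ ((↑) : s → V) := by
  rw [affineIndependent_iff]
  intro t w hw0 hw i hi
  refine linearIndependent_iff'.1 hs t w ?_ i hi
  ext
  · simpa [homogenize, Prod.fst_sum] using hw
  · simpa [homogenize, Prod.snd_sum] using hw0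

lemma exists_simplex_range_points (hs : LinearIndepOn ℝ (homogenize id) (s : Set V))
    (hm : #s = m + 1) : ∃ σ : Affine.Simplex ℝ V m, Set.range σ.points = s := by
  let e := s.equivFinOfCardEq hm
  refine ⟨⟨fun i => e.symm i,
    (affineIndependent_of_linearIndepOn_homogenize hs).comp_embedding e.symm.toEmbedding⟩, ?_⟩
  exact (e.symm.surjective.range_comp _).trans Subtype.range_coe

lemma sum_points_eq_sum {σ : Affine.Simplex ℝ V m} (hσ : Set.range σ.points = s) {M : Type*}
    [AddCommMonoid M] (f : V → M) : ∑ i, f (σ.points i) = ∑ x ∈ s, f x := by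
  have hs : s = univ.map ⟨σ.points, σ.independent.injective⟩ := by
    rw [← coe_inj, coe_map, coe_univ, Set.image_univ]
    exact hσ.symm
  rw [hs, sum_map, Function.Embedding.coeFn_mk]

lemma centerMass_mem_interior {σ : Affine.Simplex ℝ V m} (hm : 1 ≤ m)
    (hσ : Set.range σ.points = s) {w : V → ℝ} (hw : ∀ x ∈ s, 0 < w x) :
    s.centerMass w id ∈ σ.interior := by
  have hmem : ∀ i, σ.points i ∈ s := fun i => by
    rw [← mem_coe, ← hσ]
    exact Set.mem_range_self i
  have hsum : 0 < ∑ x ∈ s, w x := sum_pos hw ⟨_, hmem 0⟩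
  set w' : Fin (m + 1) → ℝ := fun i => (∑ x ∈ s, w x)⁻¹ * w (σ.points i) with hw'
  have hw'0 : ∀ i, 0 < w' i := fun i => mul_pos (inv_pos.2 hsum) (hw _ (hmem i))
  have hw'1 : ∑ i, w' i = 1 := by
    rw [hw', ← mul_sum, sum_points_eq_sum hσ w, inv_mul_cancel₀ hsum.ne']
  have hcomb : univ.affineCombination ℝ σ.points w' = s.centerMass w id := by
    rw [affineCombination_eq_linear_combination _ _ _ hw'1, centerMass,
      ← sum_points_eq_sum hσ (fun x => w x • id x), smul_sum]
    exact sum_congr rfl fun i _ => mul_smul _ _ _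
  rw [← hcomb]
  refine (Affine.Simplex.affineCombination_mem_setInterior_iff hw'1).2 fun i => ⟨hw'0 i, ?_⟩
  have : Nontrivial (Fin (m + 1)) := Fin.nontrivial_iff_two_le.2 (by omega)
  obtain ⟨j, hj⟩ := exists_ne i
  rw [← hw'1]
  exact single_lt_sum hj (mem_univ i) (mem_univ j) (hw'0 j) fun k _ _ => (hw'0 k).le

lemma ConesCross.centerMass_eq {s t : Finset V} (h : ConesCross (homogenize id) s t) :
    ∃ w : V → ℝ, (∀ x ∈ s, 0 < w x) ∧ (∀ x ∈ t, 0 < w x) ∧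
      s.centerMass w id = t.centerMass w id := by
  obtain ⟨w, hs, ht, hw⟩ := h
  have hsum : ∀ s : Finset V,
      ∑ x ∈ s, w x • homogenize id x = (∑ x ∈ s, w x • id x, ∑ x ∈ s, w x) := fun s => by
    ext <;> simp [homogenize, Prod.fst_sum, Prod.snd_sum]
  rw [hsum s, hsum t, Prod.mk_inj] at hw
  exact ⟨w, hs, ht, by rw [centerMass, centerMass, hw.1, hw.2]⟩

lemma IsConeFamily.exists_isCrossingFamily {d : ℕ} (hd : 2 ≤ d)
    {P : Finset (EuclideanSpace ℝ (Fin d))} (hP : IsGeneric (homogenize id) P)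
    {F : Finset (Finset (EuclideanSpace ℝ (Fin d)))} (hF : IsConeFamily (homogenize id) P d F) :
    ∃ F' : Finset (Affine.Simplex ℝ (EuclideanSpace ℝ (Fin d)) (d - 1)),
      IsCrossingFamily P F' ∧ #F' = #F := by
  classical
  have hsimplex : ∀ s : F, ∃ σ : Affine.Simplex ℝ (EuclideanSpace ℝ (Fin d)) (d - 1),
      Set.range σ.points = (s : Finset (EuclideanSpace ℝ (Fin d))) := fun ⟨s, hs⟩ => by
    have hs_card : #s = d - 1 + 1 := by
      rw [hF.card_eq s hs]
      omega
    exact exists_simplex_range_points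
      (hP s (hF.subset s hs) (by simp [hF.card_eq s hs])) hs_card
  choose σ hσ using hsimplex
  have hinj : Function.Injective σ := fun s t hst => by
    rw [Subtype.ext_iff, ← coe_inj, ← hσ s, ← hσ t, hst]
  refine ⟨univ.map ⟨σ, hinj⟩, ⟨?_, ?_⟩, by simp⟩
  · simp only [forall_mem_map, mem_univ, Function.Embedding.coeFn_mk, true_implies]
    refine fun s i => hF.subset s s.2 ?_
    rw [← mem_coe, ← hσ s]
    exact Set.mem_range_self i
  · simp only [forall_mem_map, mem_univ, Function.Embedding.coeFn_mk, true_implies]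
    intro s t hne
    have hst : (s : Finset (EuclideanSpace ℝ (Fin d))) ≠ t := fun h => hne (by rw [Subtype.ext h])
    obtain ⟨w, hws, hwt, hw⟩ := (hF.conesCross s.2 t.2 hst).centerMass_eq
    refine ⟨⟨_, centerMass_mem_interior (by omega) (hσ s) hws, ?_⟩, ?_⟩
    · rw [hw]
      exact centerMass_mem_interior (by omega) (hσ t) hwt
    · rw [hσ s, hσ t]
      exact disjoint_coe.2 (hF.disjoint s.2 t.2 hst)

theorem HasCrossingBound.exists_isCrossingFamily {d : ℕ} (hd : 2 ≤ d) {e : ℝ}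
    (h : HasCrossingBound d e) :
    ∃ c : ℝ, 0 < c ∧ ∀ P : Finset (EuclideanSpace ℝ (Fin d)), InGeneralPosition P → d < #P →
      ∃ F : Finset (Affine.Simplex ℝ (EuclideanSpace ℝ (Fin d)) (d - 1)),
        IsCrossingFamily P F ∧ c * (#P : ℝ) ^ e ≤ #F := by
  obtain ⟨c, hc, hF⟩ := h
  refine ⟨c, hc, fun P hP hP_card => ?_⟩
  have hgen := hP.isGeneric_homogenize hP_card
  obtain ⟨F, hF, hF_card⟩ := hF _ id P hgen hP_card
  obtain ⟨F', hF', hF'_card⟩ := hF.exists_isCrossingFamily hd hgen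
  exact ⟨F', hF', hF'_card ▸ hF_card⟩

end Simplices

theorem corollary3p4 :
    (∃ c : ℝ, 0 < c ∧
      ∀ P : Finset (EuclideanSpace ℝ (Fin 2)), InGeneralPosition P → 2 < P.card →
        ∃ F : Finset (Affine.Simplex ℝ (EuclideanSpace ℝ (Fin 2)) (2 - 1)),
          IsCrossingFamily P F ∧ c * Real.sqrt (P.card : ℝ) ≤ (F.card : ℝ)) ∧
    (∀ d : ℕ, 3 ≤ d → ∃ c : ℝ, 0 < c ∧
      ∀ P : Finset (EuclideanSpace ℝ (Fin d)), InGeneralPosition P → d < P.card →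
        ∃ F : Finset (Affine.Simplex ℝ (EuclideanSpace ℝ (Fin d)) (d - 1)),
          IsCrossingFamily P F ∧
          c * (P.card : ℝ) ^
              ((1 : ℝ) / (2 * ∏ i ∈ Finset.Icc 3 d, ((i : ℝ) ^ 2 - (i : ℝ) + 1))) ≤
            (F.card : ℝ)) := by
  refine ⟨?_, fun d hd => (hasCrossingBound (by omega)).exists_isCrossingFamily (by omega)⟩
  simp only [Real.sqrt_eq_rpow]
  exact hasCrossingBound_two.exists_isCrossingFamily le_rfl
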